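/- **Setting.** An AND-OR-NOT DAG $G=(V,E)$ has vertices $v_1,\dots,v_n$; the out-neighbours of $v_i$ form a list $D_i$ (without repetitions), $d_i=|D_i|$, $m=|E|$, $L=\{i: d_i=0\}$ is the set of sinks, and $\hat n=n-|L|$. The vertices are topologically sorted ($(v_i,v_j)\in E$ implies $i<j$) and the sinks are the last $|L|$ vertices. No vertex has $d_i=1$. Each sink $v_i$ is labelled with a Boolean variable $x(v_i)$, each other vertex with a function $h_i\in\{\mathrm{AND},\mathrm{OR}\}$, each edge $(v_i,v_j)$ with $\sigma(i,j)\in\{0,1\}$, and one non-sink vertex $v_s$ is designated as the root. For an assignment of the variables, the value of a sink is that of its variable, and the value of another vertex is $r_i=h_i\bigl(r_{j_1}^{\sigma(i,j_1)},\dots,r_{j_w}^{\sigma(i,j_w)}\bigr)$ for $D_i=(v_{j_1},\dots,v_{j_w})$, where $y^1=y$ and $y^0=\neg y$. To evaluate $G$ is to compute $r_s$. **Algorithm.** Let $t_f(j)=t[j]$ for $j\le\hat n$ and $t_f(j)=x(v_j)$ for $j>\hat n$. For $i=\hat n,\hat n-1,\dots,s$ set $$t[i]\leftarrow \hat Q_i^{k}\bigl(t_f(j_1)^{\sigma(i,j_1)},\dots,t_f(j_{w})^{\sigma(i,j_{w})}\bigr),\qquad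 D_i=(v_{j_1},\dots,v_{j_w}),\quad k=\lceil 2\log_2\hat n\rceil ,$$ and return $t[s]$. Here $\hat Q_i^k$ is a quantum query algorithm (unitaries and queries to the black box, one measurement at the end) for the function $h_i$. The black box answers queries for an entry of an adjacency list together with the label of that edge, and queries for a value $t_f(j)$. The running time is the number of queries to the black box, where one further query per processed vertex reads its label and out-degree. **Theorem 1.** There are an absolute constant $C>0$ and quantum query algorithms $\hat Q_i^k$ that, for every $k\ge1$ and every list of $d\ge 1$ arguments given through the black box, compute AND, respectively OR, of the arguments with at most $C\sqrt{kd}$ queries and error probability at most $C/2^k$, such that the algorithm above, run with them, evaluates every AND-OR-NOT DAG with $\hat n\ge2$, for every assignment of the variables, with running time at most $C\sqrt{\hat n\,m\log\hat n}$ (and hence at most $C\sqrt{n\,m\log n}$) and with error probability at most $C/\hat n$. -/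

import Mathlib

/-! ### Quantum query algorithms -/

/-- A quantum query algorithm for a black box `f : I → A` with results in `R`. Its register has the
basis states `|q, a, w⟩`: a query `q`, an answer register `a`, and a workspace `w`.
It starts in the basis state `init`, applies `U 0`, and then alternates `queries` times between one
query to the black box and the next unitary `U 1, U 2, …`. In the end the whole register is
measured once in the standard basis, and `out` is applied to the outcome. -/
structure QueryAlgorithm (I A R : Type) [Fintype I] [DecidableEq I] [Fintype A]
    [DecidableEq A] where
  /-- basis of the workspace -/
  Work : Type
  [fintypeWork : Fintype Work]
  [decEqWork : DecidableEq Work]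
  /-- number of queries to the black box -/
  queries : ℕ
  /-- the unitaries between the queries (only `U 0, …, U queries` are used) -/
  U : ℕ → Matrix.unitaryGroup (I × A × Work) ℂ
  init : I × A × Work
  out : I × A × Work → R

namespace QueryAlgorithm

attribute [instance] QueryAlgorithm.fintypeWork QueryAlgorithm.decEqWork

variable {I A R : Type} [Fintype I] [DecidableEq I] [Fintype A] [DecidableEq A]

/-- One query to the black box: the unitary `|q, a, w⟩ ↦ |q, a + f q, w⟩`, on vectors of
amplitudes. -/
def query {J B : Type} [AddGroup B] {W : Type} (f : J → B) (ψ : J × B × W → ℂ) :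
    J × B × W → ℂ :=
  fun z => ψ (z.1, z.2.1 - f z.1, z.2.2)

/-- The state after `j` queries (and the unitary that follows the last of them). -/
noncomputable def state [AddGroup A] (P : QueryAlgorithm I A R) (f : I → A) :
    ℕ → (I × A × P.Work → ℂ)
  | 0 => Matrix.mulVec (P.U 0 : Matrix _ _ ℂ) (Pi.single P.init 1)
  | j + 1 => Matrix.mulVec (P.U (j + 1) : Matrix _ _ ℂ) (query f (P.state f j))

theorem sum_norm_sq_mulVec {S : Type} [Fintype S] [DecidableEq S]
    (V : Matrix.unitaryGroup S ℂ) (ψ : S → ℂ) :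
    ∑ z, ‖Matrix.mulVec (V : Matrix S S ℂ) ψ z‖ ^ 2 = ∑ z, ‖ψ z‖ ^ 2 := by
  have key : ∀ φ : S → ℂ, ((∑ z, ‖φ z‖ ^ 2 : ℝ) : ℂ) = star φ ⬝ᵥ φ := by
    intro φ
    push_cast
    refine Finset.sum_congr rfl fun z _ => ?_
    rw [Pi.star_apply, ← Complex.conj_mul']
    rfl
  have hV : (star (V : Matrix S S ℂ)) * (V : Matrix S S ℂ) = 1 :=
    Matrix.UnitaryGroup.star_mul_self V
  have : ((∑ z, ‖Matrix.mulVec (V : Matrix S S ℂ) ψ z‖ ^ 2 : ℝ) : ℂ)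
      = ((∑ z, ‖ψ z‖ ^ 2 : ℝ) : ℂ) := by
    rw [key, key, Matrix.star_mulVec, ← Matrix.dotProduct_mulVec, Matrix.mulVec_mulVec,
      ← Matrix.star_eq_conjTranspose, hV, Matrix.one_mulVec]
  exact_mod_cast this

theorem sum_norm_sq_query {J B : Type} [Fintype J] [Fintype B] [AddGroup B] {W : Type}
    [Fintype W] (f : J → B) (ψ : J × B × W → ℂ) :
    ∑ z, ‖query f ψ z‖ ^ 2 = ∑ z, ‖ψ z‖ ^ 2 := by
  simp only [Fintype.sum_prod_type, query]
  refine Finset.sum_congr rfl fun q _ => ?_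
  exact (Equiv.subRight (f q)).sum_comp fun a => ∑ w, ‖ψ (q, a, w)‖ ^ 2

theorem sum_norm_sq_state [AddGroup A] (P : QueryAlgorithm I A R) (f : I → A) (j : ℕ) :
    ∑ z, ‖P.state f j z‖ ^ 2 = 1 := by
  induction j with
  | zero =>
    rw [state, sum_norm_sq_mulVec, Finset.sum_eq_single P.init]
    · simp
    · intro z _ hz
      simp [Pi.single_eq_of_ne hz]
    · simp
  | succ j ih => rw [state, sum_norm_sq_mulVec, sum_norm_sq_query, ih]

/-- The distribution of the result: the final measurement yields the basis state `z` with
probability `‖amplitude of z‖ ^ 2`. -/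
noncomputable def run [AddGroup A] (P : QueryAlgorithm I A R) (f : I → A) : PMF R :=
  (PMF.ofFintype (fun z => ENNReal.ofReal (‖P.state f P.queries z‖ ^ 2)) (by
    rw [← ENNReal.ofReal_sum_of_nonneg (fun z _ => by positivity), sum_norm_sq_state,
      ENNReal.ofReal_one])).map P.out

end QueryAlgorithm

/-! ### AND-OR-NOT DAGs -/

/-- A directed acyclic graph on `v_0, …, v_{n-1}`, given by its adjacency lists `D_i`, with the
vertices in topological order. -/
structure SortedDAG (n : ℕ) where
  /-- `D_i`, the list of out-neighbours of `v_i` -/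
  adj : Fin n → List (Fin n)
  adj_nodup : ∀ i, (adj i).Nodup
  topological : ∀ i, ∀ j ∈ adj i, i < j

namespace SortedDAG

variable {n : ℕ} (G : SortedDAG n)

/-- the out-degree `d_i` -/
def outDegree (i : Fin n) : ℕ := (G.adj i).length

/-- the set `E` of edges -/
def edges : Finset (Fin n × Fin n) := {e | e.2 ∈ G.adj e.1}

/-- the set `L` of sinks -/
def sinks : Finset (Fin n) := {i | G.outDegree i = 0}

/-- `n̂ = n - |L|` -/
def nHat : ℕ := n - G.sinks.card

end SortedDAG

/-- The labels of function-vertices. -/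
inductive Gate where
  | and
  | or

/-- The conjunction or disjunction of a list of Boolean values. -/
def Gate.eval : Gate → List Bool → Bool
  | .and, l => l.all id
  | .or, l => l.any id

/-- `x ^ 1 = x` and `x ^ 0 = ¬ x`. -/
def signed (x : Bool) : Bool → Bool
  | true => x
  | false => !x

/-- An AND-OR-NOT DAG with `n` vertices over `N` Boolean variables. Only the values of `gate` at
non-sinks, of `var` at sinks, and of `label` at edges have a meaning. -/
structure AndOrNotDAG (n N : ℕ) extends SortedDAG n where
  /-- the sinks are the last vertices -/
  sinks_last : ∀ i : Fin n, toSortedDAG.nHat ≤ (i : ℕ) → toSortedDAG.outDegree i = 0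
  outDegree_ne_one : ∀ i, toSortedDAG.outDegree i ≠ 1
  /-- the label of a function-vertex (out-degree at least 2) -/
  gate : Fin n → Gate
  /-- the variable that labels a variable-vertex (sink) -/
  var : Fin n → Fin N
  /-- the label `σ(i, j)` of the edge `(v_i, v_j)`; `false` is 0, the negation -/
  label : Fin n → Fin n → Bool
  /-- the index `s` of the root, a function-vertex -/
  root : Fin n
  root_lt : (root : ℕ) < toSortedDAG.nHat

namespace AndOrNotDAG

variable {n N : ℕ} (G : AndOrNotDAG n N)

/-- The value `r_i` of the vertex `v_i` under the assignment `x`. -/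
def value (x : Fin N → Bool) (i : Fin n) : Bool :=
  if G.outDegree i = 0 then x (G.var i)
  else (G.gate i).eval
    ((G.adj i).attach.map fun j => signed (value x j.1) (G.label i j.1))
termination_by n - (i : ℕ)
decreasing_by
  have h : (i : ℕ) < (j.1 : ℕ) := Fin.lt_def.mp (G.topological i j.1 j.2)
  exact Nat.sub_lt_sub_left i.isLt h

/-- `t_f(j)`: the stored value `t[j]` for `v_j` among the first `n̂` vertices, the value of the
variable for the others. -/
def tf (x : Fin N → Bool) (t : Fin n → Bool) (j : Fin n) : Bool :=
  if (j : ℕ) < G.nHat then t j else x (G.var j)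

/-- The arguments `t_f(j_1) ^ σ(i, j_1), …, t_f(j_w) ^ σ(i, j_w)` at the vertex `v_i`, where
`(v_{j_1}, …, v_{j_w}) = D_i`. -/
def args (x : Fin N → Bool) (t : Fin n → Bool) (i : Fin n) : List Bool :=
  (G.adj i).map fun j => signed (G.tf x t j) (G.label i j)

end AndOrNotDAG

/-! ### The black box -/

/-- Queries to the black box: `Sum.inl (i, p)` asks for the `p`-th entry of `D_i` (counted from 0)
and the label of that edge, `Sum.inr j` asks for the value of `v_j`. -/
abbrev Cell (n : ℕ) : Type := (Fin n × Fin n) ⊕ Fin n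

/-- Answers of the black box: a vertex (0 if none is asked for) and a bit. -/
abbrev Answer (n : ℕ) : Type := Fin n × ZMod 2

/-- A Boolean value as a bit. -/
def toBit (b : Bool) : ZMod 2 := if b then 1 else 0

/-- The black box for the graph `G` (adjacency list model), the assignment `x` and the currently
stored values `t`. -/
def AndOrNotDAG.box {n N : ℕ} [NeZero n] (G : AndOrNotDAG n N) (x : Fin N → Bool)
    (t : Fin n → Bool) : Cell n → Answer n
  | .inl (i, p) =>
    if h : (p : ℕ) < (G.adj i).length then
      ((G.adj i)[(p : ℕ)], toBit (G.label i (G.adj i)[(p : ℕ)]))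
    else (0, 0)
  | .inr j => (0, toBit (G.tf x t j))

/-! ### The evaluation algorithm -/

/-- A family of quantum subroutines: `Q n i h d k` is the subroutine `Q̂ ^ k` that is to compute
the function `h` of the `d` arguments of the vertex `v_i`. It does not depend on the graph, the
variables or the stored values, which it can reach through the black box only. -/
abbrev Subroutines : Type 1 :=
  ∀ n : ℕ, Fin n → Gate → ℕ → ℕ → QueryAlgorithm (Cell n) (Answer n) Bool

/-- `Q` consists of boosted quantum algorithms for AND and OR: on `d` arguments, and for every
`k ≥ 1`, the subroutine `Q̂ ^ k` makes `O(√(k d))` queries and errs with probability `O(1 / 2 ^ k)`,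
with the constant `C`, whatever the graph, the variables and the stored values are. -/
def IsBoosted (C : ℝ) (Q : Subroutines) : Prop :=
  ∀ (n N : ℕ) [NeZero n] (G : AndOrNotDAG n N) (i : Fin n) (h : Gate) (k : ℕ),
    G.outDegree i ≠ 0 → 1 ≤ k →
      ((Q n i h (G.outDegree i) k).queries : ℝ) ≤ C * √((k : ℝ) * (G.outDegree i : ℝ)) ∧
      ∀ (x : Fin N → Bool) (t : Fin n → Bool),
        ((Q n i h (G.outDegree i) k).run (G.box x t)).toOuterMeasure
            {b | b ≠ h.eval (G.args x t i)} ≤ ENNReal.ofReal (C / 2 ^ k)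

namespace AndOrNotDAG

variable {n N : ℕ} [NeZero n] (G : AndOrNotDAG n N)

/-- The number `2 log₂ n̂` of repetitions, rounded up. -/
noncomputable def boost : ℕ := ⌈2 * Real.logb 2 (G.nHat : ℝ)⌉₊

/-- The loop body for the vertex `v_i`, on a pair of the array `t` and a counter of the queries to
the black box. One query reads the label `h_i` and the degree `d_i`; then the subroutine for `v_i`
is run, and its result is stored in `t[i]`. -/
noncomputable def step (Q : Subroutines) (x : Fin N → Bool) (st : (Fin n → Bool) × ℕ)
    (i : Fin n) : PMF ((Fin n → Bool) × ℕ) :=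
  ((Q n i (G.gate i) (G.outDegree i) G.boost).run (G.box x st.1)).map fun b =>
    (Function.update st.1 i b,
      st.2 + 1 + (Q n i (G.gate i) (G.outDegree i) G.boost).queries)

/-- The vertices in the order of processing: from the last function-vertex down to the root. -/
def order : List (Fin n) :=
  ((List.finRange n).filter fun i => decide (G.root ≤ i ∧ (i : ℕ) < G.nHat)).reverse

/-- The evaluation algorithm: the joint distribution of the returned value `t[s]` and of the number
of queries made. The runs of the subroutines are independent of each other, given the stored values
that they read. -/
noncomputable def evalAlgorithm (Q : Subroutines) (x : Fin N → Bool) : PMF (Bool × ℕ) :=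
  (G.order.foldlM (G.step Q x) (fun _ => false, 0)).map fun st => (st.1 G.root, st.2)

end AndOrNotDAG

/-! The subroutine for a gate is a search for an argument that decides it, by a coherent mixture of
numbers of Grover iterations. Grover's iteration rotates the uniform superposition of the `d`
positions in a plane, by the angle `φ` with `cos φ = 1 - 2 t / d` if `t` positions are marked. A
control register holds `c` with amplitude `√(w c)`, and `J c` iterations are made under its
control. Then the overlap with the initial state is `f φ = ∑ c, w c * cos (J c * φ)`
(`sum_groverStep_iterate`, `QueryAlgorithm.exists_search`), so that one measurement sees whether
the register has returned to its initial state, which happens with probability `(f φ) ^ 2`. If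
nothing is marked, then `φ = 0` and `f φ = 1`: there is no error.

It remains to find a mixture `f` of low degree that is small at the angles `φ_t` of all
`t = 1, …, d` (`exists_cosineMixture_small`). Mixtures may be multiplied, and their degrees add.
Let `l = min k d`. A mixture of degree `O(√(d / t))` vanishes at `φ_t`, and the product of these
for `t ≤ l` has the degree `O(√(l d))`. The mean of `cos (a φ)` over `a < m`, with
`m = O(√(d / l))`, is in absolute value at most `1 / 2` at `φ_t` for all `t > l`, where necessarily
`l = k`, and its `l`-th power contributes the factor `1 / 2 ^ k` and the degree `O(√(l d))`. Hence
`O(√(k d))` queries give an error of at most `1 / 4 ^ k`, where `1 / 2 ^ k` suffices.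

The whole evaluation is a loop over at most `n̂` vertices, each with error `O(1 / n̂ ^ 2)` if the
values stored before are correct, so that the union bound gives `O(1 / n̂)`. The number of queries
is bounded by the Cauchy-Schwarz inequality, and does not depend on the outcomes of the
measurements. -/

/-! ### Signed permutations, state preparation and diffusion -/

namespace QueryAlgorithm

section Unitaries

variable {S T : Type} [Fintype S] [DecidableEq S] [Fintype T]

/-- Every unit vector of amplitudes can be prepared from a given basis state. -/
theorem exists_unitary_mulVec_single (i : S) (Φ : S → ℂ) (hΦ : ∑ z, ‖Φ z‖ ^ 2 = 1) :
    ∃ V : Matrix.unitaryGroup S ℂ, Matrix.mulVec (V : Matrix S S ℂ) (Pi.single i 1) = Φ := by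
  have hn : ‖WithLp.toLp 2 Φ‖ = 1 := by
    rw [EuclideanSpace.norm_eq]
    simp [hΦ]
  have ho : Orthonormal ℂ (({i} : Set S).domRestrict fun _ : S => WithLp.toLp 2 Φ) := by
    refine ⟨fun _ => hn, fun a b hab => (hab ?_).elim⟩
    exact Subsingleton.elim _ _
  obtain ⟨b, hb⟩ := ho.exists_orthonormalBasis_extension_of_card_eq
    (by simp) (ι := S)
  refine ⟨⟨(EuclideanSpace.basisFun S ℂ).toBasis.toMatrix b,
    OrthonormalBasis.toMatrix_orthonormalBasis_mem_unitary _ _⟩, ?_⟩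
  ext z
  simp [Module.Basis.toMatrix_apply, hb i rfl]

/-- The signed permutation matrix `|z⟩ ↦ ± |π z⟩`, with the sign `-1` where `φ z` is true. -/
def signedPerm (π : Equiv.Perm S) (φ : S → Bool) : Matrix.unitaryGroup S ℂ :=
  ⟨Matrix.of fun z z' => if z = π z' then (if φ z' then -1 else 1) else 0, by
    rw [Matrix.mem_unitaryGroup_iff']
    ext z z'
    simp only [Matrix.mul_apply, Matrix.star_apply, Matrix.of_apply]
    rw [Finset.sum_eq_single (π z) (fun y _ hy => by simp [hy]) (by simp)]
    by_cases h : z = z'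
    · subst h
      cases φ z <;> simp
    · simp [h]⟩

theorem signedPerm_mulVec_single (π : Equiv.Perm S) (φ : S → Bool) (z : S) (a : ℂ) :
    Matrix.mulVec (signedPerm π φ : Matrix S S ℂ) (Pi.single z a)
      = Pi.single (π z) ((if φ z then -1 else 1) * a) := by
  ext y
  by_cases h : y = π z
  · simp [signedPerm, h]
  · simp [signedPerm, h]

/-- The vector of amplitudes `∑ u, α u |g u⟩`. -/
def superpose (g : T → S) (α : T → ℂ) : S → ℂ := ∑ u, Pi.single (g u) (α u)

theorem mulVec_superpose (V : Matrix S S ℂ) (g : T → S) (α : T → ℂ) :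
    Matrix.mulVec V (superpose g α) = ∑ u, Matrix.mulVec V (Pi.single (g u) (α u)) := by
  exact map_sum (Matrix.mulVecLin V) _ _

theorem signedPerm_mulVec_superpose (π : Equiv.Perm S) (φ : S → Bool) (g : T → S) (α : T → ℂ) :
    Matrix.mulVec (signedPerm π φ : Matrix S S ℂ) (superpose g α)
      = superpose (fun u => π (g u)) (fun u => (if φ (g u) then -1 else 1) * α u) := by
  rw [mulVec_superpose]
  simp only [signedPerm_mulVec_single, superpose]

theorem signedPerm_false_mulVec_superpose (π : Equiv.Perm S) (g : T → S) (α : T → ℂ) :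
    Matrix.mulVec (signedPerm π fun _ => false : Matrix S S ℂ) (superpose g α)
      = superpose (fun u => π (g u)) α := by
  simp [signedPerm_mulVec_superpose]

theorem query_superpose {J B W : Type} [DecidableEq J] [DecidableEq B] [DecidableEq W]
    [AddGroup B] (f : J → B) (g : T → J × B × W) (α : T → ℂ) :
    query f (superpose g α)
      = superpose (fun u => ((g u).1, (g u).2.1 + f (g u).1, (g u).2.2)) α := by
  ext ⟨q, a, w⟩
  simp only [query, superpose, Finset.sum_apply, Pi.single_apply, Prod.ext_iff]
  refine Finset.sum_congr rfl fun u _ => ?_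
  congr 1
  rw [eq_iff_iff]
  constructor
  · rintro ⟨h1, h2, h3⟩
    refine ⟨h1, ?_, h3⟩
    rw [← h1, ← h2, sub_add_cancel]
  · rintro ⟨h1, h2, h3⟩
    refine ⟨h1, ?_, h3⟩
    rw [← h1] at h2
    rw [h2, add_sub_cancel_right]

/-- The inner product of two superpositions of the same distinct basis states. -/
theorem sum_star_superpose_mul_superpose {g : T → S} (hg : Function.Injective g)
    (α β : T → ℂ) :
    ∑ z, star (superpose g α z) * superpose g β z = ∑ u, star (α u) * β u := by
  have h : ∀ (γ : T → ℂ) (u : T), superpose g γ (g u) = γ u := by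
    intro γ u
    rw [superpose, Finset.sum_apply, Finset.sum_eq_single u]
    · simp
    · intro v _ hv
      exact Pi.single_eq_of_ne (fun h => hv (hg h.symm)) _
    · simp
  symm
  refine Finset.sum_of_injOn g hg.injOn (by simp) ?_ ?_
  · intro z _ hz
    have : superpose g β z = 0 := by
      rw [superpose, Finset.sum_apply]
      refine Finset.sum_eq_zero fun u _ => Pi.single_eq_of_ne (fun h => hz ⟨u, by simp, h.symm⟩) _
    rw [this, mul_zero]
  · intro u _
    rw [h, h]

end Unitaries

section Diffusion

variable {I A T W : Type} [Fintype I] [DecidableEq I] [Fintype A] [DecidableEq A]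
  [Fintype T] [DecidableEq T] [Fintype W] [DecidableEq W]

/-- The projection onto the uniform superposition of the register `T`, controlled by `p` on the
rest `W` of the workspace: where `p` fails, it is 0. -/
noncomputable def uniformProj (p : W → Bool) : Matrix (I × A × T × W) (I × A × T × W) ℂ :=
  Matrix.of fun z z' =>
    if (z.1, z.2.1, z.2.2.2) = (z'.1, z'.2.1, z'.2.2.2) ∧ p z.2.2.2
      then (Fintype.card T : ℂ)⁻¹ else 0

theorem uniformProj_mulVec_single (p : W → Bool) (q : I) (a : A) (u : T) (w : W) (x : ℂ) :
    Matrix.mulVec (uniformProj p) (Pi.single (q, a, u, w) x)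
      = if p w then ∑ v : T, Pi.single (q, a, v, w) ((Fintype.card T : ℂ)⁻¹ * x) else 0 := by
  ext ⟨q', a', v', w'⟩
  by_cases h : (q', a', w') = (q, a, w)
  · simp only [Prod.mk.injEq] at h
    obtain ⟨rfl, rfl, rfl⟩ := h
    by_cases hp : p w'
    · simp [uniformProj, hp, Finset.sum_apply, Pi.single_apply]
    · simp [uniformProj, hp]
  · have h1 : ∀ v : T, (Pi.single (q, a, v, w) ((Fintype.card T : ℂ)⁻¹ * x) :
        I × A × T × W → ℂ) (q', a', v', w') = 0 := by
      intro v
      refine Pi.single_eq_of_ne (fun h' => h ?_) _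
      simp only [Prod.mk.injEq] at h' ⊢
      exact ⟨h'.1, h'.2.1, h'.2.2.2⟩
    have h2 : (if p w then ∑ v : T, Pi.single (q, a, v, w) ((Fintype.card T : ℂ)⁻¹ * x) else 0 :
        I × A × T × W → ℂ) (q', a', v', w') = 0 := by
      split_ifs
      · rw [Finset.sum_apply, Finset.sum_eq_zero fun v _ => h1 v]
      · rfl
    rw [h2, Matrix.mulVec_single]
    simp only [uniformProj, Pi.smul_apply, Matrix.col_apply, Matrix.of_apply, h, false_and,
      if_false, smul_zero]

theorem uniformProj_mul_self [Nonempty T] (p : W → Bool) :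
    uniformProj (I := I) (A := A) (T := T) p * uniformProj p = uniformProj p := by
  rw [← Matrix.toLin'.injective.eq_iff]
  refine LinearMap.pi_ext' fun ⟨q, a, u, w⟩ => LinearMap.ext_ring ?_
  simp only [LinearMap.comp_apply, LinearMap.coe_single, Matrix.toLin'_apply,
    ← Matrix.mulVec_mulVec, uniformProj_mulVec_single]
  by_cases hp : p w
  · simp only [hp, if_true]
    rw [Matrix.mulVec_sum]
    simp only [uniformProj_mulVec_single, hp, if_true, Finset.sum_const, Finset.card_univ,
      Finset.smul_sum, ← Pi.single_smul]
    refine Finset.sum_congr rfl fun v _ => ?_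
    congr 1
    rw [nsmul_eq_mul]
    field_simp
  · simp [hp]

/-- The reflection `1 - 2 P` for the projection `P` onto the uniform superposition of the register
`T`, controlled by `p`. Where `p` holds, this is the negative of Grover's diffusion
operator, and elsewhere the identity. -/
noncomputable def diffusion [Nonempty T] (p : W → Bool) :
    Matrix.unitaryGroup (I × A × T × W) ℂ :=
  ⟨1 - 2 • uniformProj p, by
    have hs : star (uniformProj (I := I) (A := A) (T := T) p) = uniformProj p := by
      ext z z'
      simp only [uniformProj, Matrix.star_apply, Matrix.of_apply, apply_ite star, star_zero,
        star_inv₀, star_natCast]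
      congr 1
      rw [eq_iff_iff]
      constructor <;>
      · rintro ⟨h, hp⟩
        refine ⟨h.symm, ?_⟩
        simp only [Prod.mk.injEq] at h
        rwa [← h.2.2]
    rw [Matrix.mem_unitaryGroup_iff, star_sub, star_one, star_nsmul, hs]
    have := uniformProj_mul_self (I := I) (A := A) (T := T) p
    simp only [sub_mul, mul_sub, one_mul, mul_one, smul_mul_assoc, mul_smul_comm, this]
    abel⟩

theorem diffusion_mulVec_superpose [Nonempty T] {ι : Type} [Fintype ι] [DecidableEq ι]
    (p : W → Bool) (q : I) (a : A) (w : ι → W) (α : T × ι → ℂ) :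
    Matrix.mulVec (diffusion p : Matrix.unitaryGroup (I × A × T × W) ℂ).1
        (superpose (fun u : T × ι => (q, a, u.1, w u.2)) α)
      = superpose (fun u : T × ι => (q, a, u.1, w u.2)) fun u =>
          α u - if p (w u.2) then 2 * ((Fintype.card T : ℂ)⁻¹ * ∑ v : T, α (v, u.2)) else 0 := by
  rw [mulVec_superpose]
  simp only [diffusion, Matrix.sub_mulVec, Matrix.one_mulVec,
    Matrix.smul_mulVec, uniformProj_mulVec_single, Finset.sum_sub_distrib, superpose,
    Pi.single_sub]
  congr 1
  rw [Fintype.sum_prod_type_right, Fintype.sum_prod_type_right]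
  refine Finset.sum_congr rfl fun c _ => ?_
  by_cases hp : p (w c)
  · simp only [hp, if_true]
    rw [← Finset.smul_sum, Finset.sum_comm, Finset.smul_sum]
    refine Finset.sum_congr rfl fun v _ => ?_
    ext z
    simp [Pi.single_apply, Finset.sum_apply, Finset.mul_sum, Finset.sum_ite_irrel]
  · simp [hp]

end Diffusion

end QueryAlgorithm

/-! ### Mixtures of cosines -/

/-- The convex combinations of the functions `φ ↦ cos (j φ)` with `j ≤ M`. These are the overlaps
with the initial state that a coherent mixture of at most `M` Grover iterations can have. -/
def cosineMixtures (M : ℕ) : Set (ℝ → ℝ) :=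
  convexHull ℝ {f | ∃ j ≤ M, f = fun φ => Real.cos (j * φ)}

theorem convex_cosineMixtures (M : ℕ) : Convex ℝ (cosineMixtures M) := convex_convexHull _ _

theorem cos_mem_cosineMixtures {j M : ℕ} (h : j ≤ M) :
    (fun φ => Real.cos (j * φ)) ∈ cosineMixtures M :=
  subset_convexHull _ _ ⟨j, h, rfl⟩

theorem one_mem_cosineMixtures (M : ℕ) : (1 : ℝ → ℝ) ∈ cosineMixtures M := by
  convert cos_mem_cosineMixtures M.zero_le using 1
  ext φ
  simp

/-- Since `cos (i φ) cos (j φ)` is the mean of `cos ((i + j) φ)` and `cos ((i - j) φ)`, mixtures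
may be multiplied, and the degrees add. -/
theorem mul_mem_cosineMixtures {M N : ℕ} {f g : ℝ → ℝ} (hf : f ∈ cosineMixtures M)
    (hg : g ∈ cosineMixtures N) : f * g ∈ cosineMixtures (M + N) := by
  have hright : ∀ g : ℝ → ℝ, Convex ℝ {f | f * g ∈ cosineMixtures (M + N)} := fun g =>
    (convex_cosineMixtures _).linear_preimage (LinearMap.mulRight ℝ g)
  have hleft : ∀ f : ℝ → ℝ, Convex ℝ {g | f * g ∈ cosineMixtures (M + N)} := fun f =>
    (convex_cosineMixtures _).linear_preimage (LinearMap.mulLeft ℝ f)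
  refine convexHull_min ?_ (hright g) hf
  rintro _ ⟨i, hi, rfl⟩
  refine convexHull_min ?_ (hleft _) hg
  rintro _ ⟨j, hj, rfl⟩
  have hd : (max i j - min i j : ℕ) ≤ M + N := by omega
  have := convex_cosineMixtures (M + N) (cos_mem_cosineMixtures (add_le_add hi hj))
    (cos_mem_cosineMixtures hd) (a := 1 / 2) (b := 1 / 2) (by norm_num) (by norm_num) (by norm_num)
  refine Set.mem_of_eq_of_mem (s := cosineMixtures (M + N)) ?_ this
  ext φ
  have hcos : Real.cos (((max i j - min i j : ℕ) : ℝ) * φ) = Real.cos (i * φ - j * φ) := by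
    rcases le_total i j with h | h
    · rw [max_eq_right h, min_eq_left h, Nat.cast_sub h, ← Real.cos_neg]
      ring_nf
    · rw [max_eq_left h, min_eq_right h, Nat.cast_sub h]
      ring_nf
  simp only [Pi.mul_apply, Pi.add_apply, Pi.smul_apply, smul_eq_mul, hcos, Nat.cast_add, add_mul,
    Real.cos_add, Real.cos_sub]
  ring

theorem pow_mem_cosineMixtures {M : ℕ} {f : ℝ → ℝ} (hf : f ∈ cosineMixtures M) (k : ℕ) :
    f ^ k ∈ cosineMixtures (k * M) := by
  induction k with
  | zero => exact one_mem_cosineMixtures _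
  | succ k ih =>
    rw [pow_succ, add_mul, one_mul]
    exact mul_mem_cosineMixtures ih hf

theorem prod_mem_cosineMixtures {κ : Type*} (s : Finset κ) {M : κ → ℕ} {f : κ → ℝ → ℝ}
    (hf : ∀ t ∈ s, f t ∈ cosineMixtures (M t)) :
    ∏ t ∈ s, f t ∈ cosineMixtures (∑ t ∈ s, M t) := by
  classical
  induction s using Finset.induction_on with
  | empty => exact one_mem_cosineMixtures _
  | insert t s ht ih =>
    rw [Finset.prod_insert ht, Finset.sum_insert ht]
    exact mul_mem_cosineMixtures (hf t (Finset.mem_insert_self t s))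
      (ih fun u hu => hf u (Finset.mem_insert_of_mem hu))

theorem abs_le_one_of_mem_cosineMixtures {M : ℕ} {f : ℝ → ℝ} (hf : f ∈ cosineMixtures M)
    (φ : ℝ) : |f φ| ≤ 1 := by
  have hc : Convex ℝ {f : ℝ → ℝ | f φ ∈ Set.Icc (-1) 1} :=
    (convex_Icc (-1 : ℝ) 1).linear_preimage
      (LinearMap.proj φ : (ℝ → ℝ) →ₗ[ℝ] ℝ)
  have : f φ ∈ Set.Icc (-1 : ℝ) 1 := by
    refine convexHull_min ?_ hc hf
    rintro _ ⟨j, _, rfl⟩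
    exact ⟨Real.neg_one_le_cos _, Real.cos_le_one _⟩
  exact abs_le.mpr this

/-- Mixing `1` and `cos (j φ)`, for the `j` with `π / 2 ≤ j φ ≤ π`, gives a zero at `φ`. -/
theorem exists_mem_cosineMixtures_eq_zero {φ : ℝ} (h0 : 0 < φ) (hπ : φ ≤ Real.pi) :
    ∃ f ∈ cosineMixtures ⌊Real.pi / φ⌋₊, f φ = 0 := by
  set j := ⌊Real.pi / φ⌋₊ with hj
  have h1 : (j : ℝ) * φ ≤ Real.pi := by
    rw [← le_div_iff₀ h0]
    exact Nat.floor_le (by positivity)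
  have h2 : Real.pi < (j + 1 : ℝ) * φ := by
    rw [← div_lt_iff₀ h0]
    exact Nat.lt_floor_add_one _
  have h3 : (1 : ℝ) ≤ j := by
    exact_mod_cast Nat.le_floor (by rw [Nat.cast_one, le_div_iff₀ h0]; linarith)
  have hc : Real.cos (j * φ) ≤ 0 := by
    apply Real.cos_nonpos_of_pi_div_two_le_of_le
    · nlinarith
    · linarith [Real.pi_pos]
  set c := Real.cos (j * φ) with hcdef
  refine ⟨_, convex_cosineMixtures j (one_mem_cosineMixtures j) (cos_mem_cosineMixtures le_rfl)
    (a := -c / (1 - c)) (b := 1 / (1 - c)) (div_nonneg (by linarith) (by linarith))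
    (div_nonneg (by linarith) (by linarith)) ?_, ?_⟩
  · rw [← add_div]
    exact (div_eq_one_iff_eq (by linarith)).mpr (by ring)
  · simp only [Pi.add_apply, Pi.smul_apply, Pi.one_apply, smul_eq_mul, ← hcdef]
    ring

/-- The mean of `cos (a φ)` over `a < m` is the real part of a geometric sum, and hence at most
`2 / (m |exp (i φ) - 1|) = 1 / (m |sin (φ / 2)|)`. -/
theorem exists_mem_cosineMixtures_abs_le {m : ℕ} (hm : 0 < m) :
    ∃ f ∈ cosineMixtures (m - 1), ∀ φ : ℝ, 0 < Real.sin (φ / 2) →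
      |f φ| ≤ 1 / (m * Real.sin (φ / 2)) := by
  have hm' : (0 : ℝ) < m := by exact_mod_cast hm
  refine ⟨∑ a ∈ Finset.range m, (1 / (m : ℝ)) • fun φ => Real.cos (a * φ),
    (convex_cosineMixtures _).sum_mem (fun _ _ => by positivity) ?_ ?_, ?_⟩
  · simp [hm'.ne']
  · intro a ha
    exact cos_mem_cosineMixtures (by have := Finset.mem_range.mp ha; omega)
  · intro φ hφ
    set z : ℂ := Complex.exp (φ * Complex.I) with hz
    have hsum : (∑ a ∈ Finset.range m, (1 / (m : ℝ)) • fun φ : ℝ => Real.cos (a * φ)) φ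
        = 1 / (m : ℝ) * (∑ a ∈ Finset.range m, z ^ a).re := by
      rw [Finset.sum_apply, Complex.re_sum, Finset.mul_sum]
      refine Finset.sum_congr rfl fun a _ => ?_
      rw [hz, ← Complex.exp_nat_mul, ← mul_assoc, ← Complex.ofReal_natCast, ← Complex.ofReal_mul,
        Complex.exp_ofReal_mul_I_re]
      rfl
    have hz1 : ‖z - 1‖ = 2 * Real.sin (φ / 2) := by
      rw [hz, mul_comm, Complex.norm_exp_I_mul_ofReal_sub_one, Real.norm_eq_abs,
        abs_of_pos (by positivity)]
    have hzn : ‖z‖ = 1 := Complex.norm_exp_ofReal_mul_I φ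
    have hgeom : ‖∑ a ∈ Finset.range m, z ^ a‖ * ‖z - 1‖ ≤ 2 := by
      rw [← norm_mul, geom_sum_mul]
      refine (norm_sub_le _ _).trans ?_
      rw [norm_pow, hzn, one_pow, norm_one]
      norm_num
    have hre : |(∑ a ∈ Finset.range m, z ^ a).re| ≤ 1 / Real.sin (φ / 2) := by
      refine (Complex.abs_re_le_norm _).trans ?_
      rw [le_div_iff₀ hφ]
      rw [hz1] at hgeom
      linarith
    rw [hsum, abs_mul, abs_of_pos (by positivity), one_div_mul_eq_div, ← div_div, div_right_comm]
    exact div_le_div_of_nonneg_right hre hm'.le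

theorem sum_one_div_sqrt_le (k : ℕ) :
    ∑ t ∈ Finset.Icc 1 k, 1 / √(t : ℝ) ≤ 2 * √(k : ℝ) := by
  induction k with
  | zero => simp
  | succ k ih =>
    rw [Finset.sum_Icc_succ_top (by omega)]
    have h1 : (0 : ℝ) < √((k + 1 : ℕ) : ℝ) := Real.sqrt_pos.mpr (by positivity)
    have h2 := Real.sq_sqrt (show (0 : ℝ) ≤ ((k + 1 : ℕ) : ℝ) by positivity)
    have h3 := Real.sq_sqrt (show (0 : ℝ) ≤ (k : ℝ) by positivity)
    have h4 := Real.sqrt_nonneg (k : ℝ)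
    have : 1 / √((k + 1 : ℕ) : ℝ) ≤ 2 * √((k + 1 : ℕ) : ℝ) - 2 * √(k : ℝ) := by
      rw [div_le_iff₀ h1]
      push_cast at *
      nlinarith [sq_nonneg (√((k : ℝ) + 1) - √(k : ℝ))]
    linarith

/-- The angle `φ` of Grover's rotation for the fraction `r` of marked positions satisfies
`cos φ = 1 - 2 r`, and hence `sin (φ / 2) = √r ≤ φ / 2`. -/
theorem sin_half_arccos {r : ℝ} (h0 : 0 ≤ r) (h1 : r ≤ 1) :
    Real.sin (Real.arccos (1 - 2 * r) / 2) = √r := by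
  rw [Real.sin_half_eq_sqrt (Real.arccos_nonneg _) (by linarith [Real.arccos_le_pi (1 - 2 * r),
    Real.pi_pos]), Real.cos_arccos (by linarith) (by linarith)]
  ring_nf

theorem two_mul_sqrt_le_arccos {r : ℝ} (h0 : 0 ≤ r) (h1 : r ≤ 1) :
    2 * √r ≤ Real.arccos (1 - 2 * r) := by
  have := Real.sin_le (x := Real.arccos (1 - 2 * r) / 2)
    (by linarith [Real.arccos_nonneg (1 - 2 * r)])
  rw [sin_half_arccos h0 h1] at this
  linarith

/-- The mixture vanishes at the angles for `t ≤ min k d` marked positions out of `d`, at the cost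
of a degree `≤ 2 √(d / t)` for each, and is at most `1 / 2 ^ k` in absolute value at the others, of
which there are none unless `k < d`. -/
theorem exists_cosineMixture_small {d k : ℕ} (hd : 1 ≤ d) (hk : 1 ≤ k) :
    ∃ M : ℕ, (M : ℝ) ≤ 6 * √((k : ℝ) * d) ∧ ∃ f ∈ cosineMixtures M,
      ∀ t ∈ Finset.Icc 1 d, |f (Real.arccos (1 - 2 * ((t : ℝ) / d)))| ≤ 1 / 2 ^ k := by
  have hd0 : (0 : ℝ) < d := by exact_mod_cast hd
  set l := min k d with hl
  have hl1 : 1 ≤ l := by omega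
  have hl0 : (0 : ℝ) < l := by exact_mod_cast hl1
  set φ : ℕ → ℝ := fun t => Real.arccos (1 - 2 * ((t : ℝ) / d)) with hφ
  have hle : ∀ t ∈ Finset.Icc 1 d, (t : ℝ) / d ≤ 1 := fun t ht => by
    rw [div_le_one hd0]
    exact_mod_cast (Finset.mem_Icc.mp ht).2
  have hpos : ∀ t ∈ Finset.Icc 1 d, 0 < √((t : ℝ) / d) := fun t ht => by
    have : 0 < t := (Finset.mem_Icc.mp ht).1
    exact Real.sqrt_pos.mpr (by positivity)
  have hφle : ∀ t ∈ Finset.Icc 1 d, 2 * √((t : ℝ) / d) ≤ φ t := fun t ht =>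
    two_mul_sqrt_le_arccos (by positivity) (hle t ht)
  have hz : ∀ t ∈ Finset.Icc 1 d, ∃ f ∈ cosineMixtures ⌊Real.pi / φ t⌋₊, f (φ t) = 0 :=
    fun t ht => exists_mem_cosineMixtures_eq_zero
      (by linarith [hpos t ht, hφle t ht]) (Real.arccos_le_pi _)
  choose! F hFmem hFzero using hz
  -- at `t > l`, the bound `1 / (m √(t / d))` for the mean of `m` cosines is at most `1 / 2`
  set m := ⌈2 * √((d : ℝ) / l)⌉₊ with hm
  have hm0 : 0 < m := Nat.ceil_pos.mpr (by positivity)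
  obtain ⟨g, hg, hgle⟩ := exists_mem_cosineMixtures_abs_le hm0
  have hsub : ∀ t ∈ Finset.Icc 1 l, t ∈ Finset.Icc 1 d := fun t ht => by
    rw [Finset.mem_Icc] at ht ⊢
    omega
  refine ⟨∑ t ∈ Finset.Icc 1 l, ⌊Real.pi / φ t⌋₊ + l * (m - 1), ?_,
    (∏ t ∈ Finset.Icc 1 l, F t) * g ^ l, mul_mem_cosineMixtures
      (prod_mem_cosineMixtures _ fun t ht => hFmem t (hsub t ht)) (pow_mem_cosineMixtures hg l), ?_⟩
  · have hsum : (∑ t ∈ Finset.Icc 1 l, (⌊Real.pi / φ t⌋₊ : ℝ)) ≤ 4 * √((l : ℝ) * d) := by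
      calc (∑ t ∈ Finset.Icc 1 l, (⌊Real.pi / φ t⌋₊ : ℝ))
          ≤ ∑ t ∈ Finset.Icc 1 l, 2 * √(d : ℝ) * (1 / √(t : ℝ)) := by
            refine Finset.sum_le_sum fun t ht => ?_
            have htd := hsub t ht
            have ht0 : (0 : ℝ) < t := by exact_mod_cast (Finset.mem_Icc.mp ht).1
            have h1 := hφle t htd
            have h2 := hpos t htd
            refine (Nat.floor_le (div_nonneg Real.pi_pos.le (by linarith))).trans ?_
            calc Real.pi / φ t ≤ 4 / (2 * √((t : ℝ) / d)) :=
                  div_le_div₀ (by norm_num) Real.pi_le_four (by positivity) h1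
              _ = 2 * √(d : ℝ) * (1 / √(t : ℝ)) := by
                  rw [Real.sqrt_div ht0.le]
                  field_simp
                  norm_num
        _ = 2 * √(d : ℝ) * ∑ t ∈ Finset.Icc 1 l, 1 / √(t : ℝ) := by rw [Finset.mul_sum]
        _ ≤ 2 * √(d : ℝ) * (2 * √(l : ℝ)) := by
            gcongr
            exact sum_one_div_sqrt_le l
        _ = 4 * √((l : ℝ) * d) := by
            rw [Real.sqrt_mul hl0.le]
            ring
    have hpow : (l : ℝ) * ((m - 1 : ℕ) : ℝ) ≤ 2 * √((l : ℝ) * d) := by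
      have h1 : ((m - 1 : ℕ) : ℝ) ≤ 2 * √((d : ℝ) / l) := by
        rw [Nat.cast_sub hm0, Nat.cast_one]
        linarith [Nat.ceil_lt_add_one (show 0 ≤ 2 * √((d : ℝ) / l) by positivity)]
      calc (l : ℝ) * ((m - 1 : ℕ) : ℝ) ≤ l * (2 * √((d : ℝ) / l)) := by gcongr
        _ = 2 * √((l : ℝ) * d) := by
            rw [Real.sqrt_div hd0.le, Real.sqrt_mul hl0.le]
            have := Real.sq_sqrt hl0.le
            have h3 : √(l : ℝ) ≠ 0 := (Real.sqrt_pos.mpr hl0).ne'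
            field_simp
            rw [this]
    have hlk : √((l : ℝ) * d) ≤ √((k : ℝ) * d) := by
      apply Real.sqrt_le_sqrt
      have : (l : ℝ) ≤ k := by exact_mod_cast min_le_left k d
      gcongr
    push_cast
    linarith
  · intro t ht
    rw [Pi.mul_apply, Finset.prod_apply, Pi.pow_apply]
    by_cases htl : t ≤ l
    · rw [Finset.prod_eq_zero (Finset.mem_Icc.mpr ⟨(Finset.mem_Icc.mp ht).1, htl⟩)
        (hFzero t ht), zero_mul, abs_zero]
      positivity
    · have hlk : l = k := by
        have := (Finset.mem_Icc.mp ht).2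
        omega
      have hgt : |g (φ t)| ≤ 1 / 2 := by
        have hsin : Real.sin (φ t / 2) = √((t : ℝ) / d) :=
          sin_half_arccos (by positivity) (hle t ht)
        have h1 := hgle (φ t) (by rw [hsin]; exact hpos t ht)
        refine h1.trans (one_div_le_one_div_of_le two_pos ?_)
        rw [hsin]
        have hlt : √((l : ℝ) / d) ≤ √((t : ℝ) / d) := by
          apply Real.sqrt_le_sqrt
          have : (l : ℝ) ≤ t := by exact_mod_cast (not_le.mp htl).le
          gcongr
        calc (2 : ℝ) = 2 * √((d : ℝ) / l) * √((l : ℝ) / d) := by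
              rw [mul_assoc, ← Real.sqrt_mul (by positivity), div_mul_div_cancel₀ hl0.ne',
                div_self hd0.ne', Real.sqrt_one, mul_one]
          _ ≤ m * √((t : ℝ) / d) := by
              gcongr
              exact Nat.le_ceil _
      rw [abs_mul, abs_pow]
      have hprod := abs_le_one_of_mem_cosineMixtures
        (prod_mem_cosineMixtures _ fun t ht => hFmem t (hsub t ht)) (φ t)
      rw [Finset.prod_apply] at hprod
      calc |∏ c ∈ Finset.Icc 1 l, F c (φ t)| * |g (φ t)| ^ l ≤ 1 * (1 / 2) ^ l := by gcongr
        _ = 1 / 2 ^ k := by rw [one_mul, one_div_pow, hlk]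

/-! ### Search with a mixture of numbers of Grover iterations -/

/-- One iteration of Grover's search on real amplitudes: the sign of the amplitudes at the unmarked
positions is changed, and then twice the mean is subtracted. -/
noncomputable def groverStep {T : Type} [Fintype T] (marked : T → Bool) (u : T → ℝ) : T → ℝ :=
  fun p => (if marked p then u p else -u p)
    - 2 * ((Fintype.card T : ℝ)⁻¹ * ∑ v : T, if marked v then u v else -u v)

/-- The plane spanned by the uniform superposition and its marked part is invariant under Grover's
iteration, which rotates it by the angle `φ`. -/
theorem exists_groverStep_iterate_eq {T : Type} [Fintype T] [Nonempty T] (marked : T → Bool)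
    {φ : ℝ} (hφ : Real.cos φ
      = 1 - 2 * (((Finset.univ.filter fun p => marked p).card : ℝ) / Fintype.card T))
    (s : ℝ) (j : ℕ) :
    ∃ a b : ℝ, (groverStep marked)^[j] (fun _ => s)
        = (fun p => (a + if marked p then b else 0) * s) ∧
      a + (((Finset.univ.filter fun p => marked p).card : ℝ) / Fintype.card T) * b
        = Real.cos (j * φ) ∧
      a * Real.cos φ - (((Finset.univ.filter fun p => marked p).card : ℝ) / Fintype.card T) * b
        = Real.cos ((j + 1) * φ) := by
  set r : ℝ := ((Finset.univ.filter fun p => marked p).card : ℝ) / Fintype.card T with hr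
  have hd : (Fintype.card T : ℝ) ≠ 0 := by exact_mod_cast Fintype.card_ne_zero
  induction j with
  | zero => exact ⟨1, 0, by simp, by simp, by simp⟩
  | succ j ih =>
    obtain ⟨a, b, hu, h1, h2⟩ := ih
    have hsum : (Fintype.card T : ℝ)⁻¹ * ∑ v : T, (if marked v then
          (a + if marked v then b else 0) * s else -((a + if marked v then b else 0) * s))
        = (-a + r * (2 * a + b)) * s := by
      have : ∀ v : T, (if marked v then
          (a + if marked v then b else 0) * s else -((a + if marked v then b else 0) * s))
          = -a * s + if marked v then (2 * a + b) * s else 0 := by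
        intro v
        split_ifs <;> ring
      simp only [this, Finset.sum_add_distrib, Finset.sum_const, Finset.card_univ,
        ← Finset.sum_filter, nsmul_eq_mul, hr]
      field_simp
    refine ⟨a * (1 - 4 * r) - 2 * r * b, 2 * a + b, ?_, ?_, ?_⟩
    · rw [Function.iterate_succ_apply', hu]
      ext p
      rw [groverStep, hsum]
      split_ifs <;> ring
    · rw [hφ] at h2
      push_cast
      rw [← h2]
      ring
    · have hrec : Real.cos (((j + 1 : ℕ) + 1 : ℝ) * φ)
          = 2 * Real.cos φ * Real.cos ((j + 1) * φ) - Real.cos (j * φ) := by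
        have e1 : ((j + 1 : ℕ) + 1 : ℝ) * φ = (j + 1) * φ + φ := by push_cast; ring
        have e2 : (j : ℝ) * φ = (j + 1) * φ - φ := by ring
        rw [e1, e2, Real.cos_add, Real.cos_sub]
        ring
      rw [hrec, ← h2, ← h1, hφ]
      ring

theorem sum_groverStep_iterate {T : Type} [Fintype T] [Nonempty T] (marked : T → Bool)
    {φ : ℝ} (hφ : Real.cos φ
      = 1 - 2 * (((Finset.univ.filter fun p => marked p).card : ℝ) / Fintype.card T)) (j : ℕ) :
    ∑ p, 1 / √(Fintype.card T : ℝ)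
        * (groverStep marked)^[j] (fun _ => 1 / √(Fintype.card T : ℝ)) p
      = Real.cos (j * φ) := by
  obtain ⟨a, b, hu, h1, -⟩ := exists_groverStep_iterate_eq marked hφ (1 / √(Fintype.card T : ℝ)) j
  have hd : (0 : ℝ) < Fintype.card T := by exact_mod_cast Fintype.card_pos
  have hs : 1 / √(Fintype.card T : ℝ) * (1 / √(Fintype.card T : ℝ)) = (Fintype.card T : ℝ)⁻¹ := by
    rw [div_mul_div_comm, Real.mul_self_sqrt hd.le, one_mul, one_div]
  rw [hu, ← h1]
  simp only [mul_comm (_ + _) (1 / √(Fintype.card T : ℝ)), ← mul_assoc, hs]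
  rw [← Finset.mul_sum, Finset.sum_add_distrib, Finset.sum_const, Finset.card_univ,
    ← Finset.sum_filter, Finset.sum_const]
  simp only [nsmul_eq_mul]
  field_simp

namespace QueryAlgorithm

/-- The algorithm `P` followed by the unitary `V`. -/
def withFinal {I A R : Type} [Fintype I] [DecidableEq I] [Fintype A] [DecidableEq A]
    (P : QueryAlgorithm I A R) (V : Matrix.unitaryGroup (I × A × P.Work) ℂ) :
    QueryAlgorithm I A R :=
  { P with U := fun j => if j = P.queries then V * P.U j else P.U j }

theorem withFinal_state {I A R : Type} [Fintype I] [DecidableEq I] [Fintype A] [DecidableEq A]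
    [AddGroup A] (P : QueryAlgorithm I A R) (V : Matrix.unitaryGroup (I × A × P.Work) ℂ)
    (f : I → A) :
    (P.withFinal V).state f P.queries = Matrix.mulVec V.1 (P.state f P.queries) := by
  have hlt : ∀ j < P.queries, (P.withFinal V).state f j = P.state f j := by
    intro j
    induction j with
    | zero =>
      intro hj
      change Matrix.mulVec (if 0 = P.queries then V * P.U 0 else P.U 0).1 _ = _
      rw [if_neg hj.ne]
      rfl
    | succ j ih =>
      intro hj
      change Matrix.mulVec (if j + 1 = P.queries then V * P.U (j + 1) else P.U (j + 1)).1
        (query f ((P.withFinal V).state f j)) = _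
      rw [if_neg hj.ne, ih (by omega)]
      rfl
  rcases hq : P.queries with _ | j
  · change Matrix.mulVec (if 0 = P.queries then V * P.U 0 else P.U 0).1 _ = _
    rw [if_pos hq.symm]
    exact (Matrix.mulVec_mulVec _ _ _).symm
  · change Matrix.mulVec (if j + 1 = P.queries then V * P.U (j + 1) else P.U (j + 1)).1
      (query f ((P.withFinal V).state f j)) = _
    rw [if_pos hq.symm, hlt j (by omega)]
    exact (Matrix.mulVec_mulVec _ _ _).symm

section Search

variable {I A T ι : Type}

/-- Exchanges the blank query `q₀` and the query that `key` finds in the other registers. -/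
def load [DecidableEq I] (q₀ : I) (key : A × T × A × ι → I) : Equiv.Perm (I × A × T × A × ι) :=
  Function.Involutive.toPerm (fun z => (Equiv.swap q₀ (key z.2) z.1, z.2)) fun z => by simp

/-- Exchanges the answer register and the part of the workspace that can hold an answer. -/
def exchange : Equiv.Perm (I × A × T × A × ι) :=
  Function.Involutive.toPerm (fun z => (z.1, z.2.2.2.1, z.2.2.1, z.2.1, z.2.2.2.2)) fun _ => rfl

/-- Negates the answer register, so that the next query adds to `-f q`, and not to `f q`. -/
def negAnswer [AddGroup A] : Equiv.Perm (I × A × T × A × ι) :=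
  Function.Involutive.toPerm (fun z => (z.1, -z.2.1, z.2.2)) fun z => by simp

@[simp]
theorem load_apply [DecidableEq I] (q₀ : I) (key : A × T × A × ι → I) (z : I × A × T × A × ι) :
    load q₀ key z = (Equiv.swap q₀ (key z.2) z.1, z.2) := rfl

@[simp]
theorem exchange_apply (z : I × A × T × A × ι) :
    exchange z = (z.1, z.2.2.2.1, z.2.2.1, z.2.1, z.2.2.2.2) := rfl

@[simp]
theorem negAnswer_apply [AddGroup A] (z : I × A × T × A × ι) :
    negAnswer z = (z.1, -z.2.1, z.2.2) := rfl

/-- The amplitude at the position `p` and the value `c` of the control register, after `r`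
iterations. -/
noncomputable def searchAmplitude [Fintype T] (marked : T → Bool) (w : ι → ℝ) (J : ι → ℕ) (r : ℕ)
    (u : T × ι) : ℂ :=
  ((√(w u.2) *
    (groverStep marked)^[min r (J u.2)] (fun _ => 1 / √(Fintype.card T : ℝ)) u.1 : ℝ) : ℂ)

theorem searchAmplitude_succ [Fintype T] (marked : T → Bool) (w : ι → ℝ) (J : ι → ℕ) (r : ℕ)
    (u : T × ι) :
    searchAmplitude marked w J (r + 1) u
      = (if (decide (r < J u.2) && !marked u.1) then -1 else 1) * searchAmplitude marked w J r u
        - if decide (r < J u.2) then 2 * ((Fintype.card T : ℂ)⁻¹ *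
          ∑ v : T, (if (decide (r < J u.2) && !marked v) then -1 else 1)
            * searchAmplitude marked w J r (v, u.2)) else 0 := by
  by_cases h : r < J u.2
  · have h1 : min (r + 1) (J u.2) = r + 1 := min_eq_left h
    have h2 : min r (J u.2) = r := min_eq_left h.le
    simp only [searchAmplitude, h1, h2, Function.iterate_succ_apply', h, decide_true,
      Bool.true_and, if_true]
    simp only [groverStep]
    push_cast
    have h3 : ∀ v : T, (if (!marked v) = true then (-1 : ℂ) else 1) *
        (((√(w u.2) : ℝ) : ℂ) *
          (((groverStep marked)^[r] (fun _ => 1 / √(Fintype.card T : ℝ)) v : ℝ) : ℂ))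
        = ((√(w u.2) : ℝ) : ℂ) * ((if marked v then
            (groverStep marked)^[r] (fun _ => 1 / √(Fintype.card T : ℝ)) v
          else -(groverStep marked)^[r] (fun _ => 1 / √(Fintype.card T : ℝ)) v : ℝ) : ℂ) := by
      intro v
      cases marked v <;> simp
    simp only [h3, ← Finset.mul_sum]
    ring
  · have h1 : min (r + 1) (J u.2) = J u.2 := min_eq_right (by omega)
    have h2 : min r (J u.2) = J u.2 := min_eq_right (by omega)
    simp [searchAmplitude, h1, h2, h]

variable [Fintype I] [DecidableEq I] [Fintype A] [DecidableEq A] [AddGroup A]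
  [Fintype T] [DecidableEq T] [Nonempty T] [Fintype ι] [DecidableEq ι]

/-- The unitaries of Grover's search for a position `p : T` at which
`marked (f (q₁ p)) (f (q₂ (f (q₁ p))))` holds, `f` being the black box. The basis states are
`|q, a, p, b, c⟩` with the query `q`, the answer register `a`, the position `p`, a stored answer
`b`, and a control register `c`. An iteration makes four queries: two of them compute `f (q₁ p)`
and `f (q₂ (f (q₁ p)))`, then the sign is changed at the unmarked positions (as `diffusion` is the
negative of Grover's operator), and the other two clear the registers. The
`r`-th iteration acts only where `r < J c`, so that `J c` iterations are made for the value `c` of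
the control register. The initial state is prepared by `V`. -/
noncomputable def searchUnitary (q₀ : I) (q₁ : T → I) (q₂ : A → I)
    (marked : A → A → Bool) (J : ι → ℕ) (V : Matrix.unitaryGroup (I × A × T × A × ι) ℂ) :
    ℕ → Matrix.unitaryGroup (I × A × T × A × ι) ℂ
  | 0 => signedPerm (load q₀ fun z => q₁ z.2.1) (fun _ => false) * V
  | j + 1 =>
    match j % 4 with
    | 0 => signedPerm (((load q₀ fun z => q₁ z.2.1).trans exchange).trans
        (load q₀ fun z => q₂ z.2.2.1)) fun _ => false
    | 1 => signedPerm negAnswer fun z =>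
        decide (j / 4 < J z.2.2.2.2) && !marked z.2.2.2.1 z.2.1
    | 2 => signedPerm ((((load q₀ fun z => q₂ z.2.2.1).trans exchange).trans negAnswer).trans
        (load q₀ fun z => q₁ z.2.1)) fun _ => false
    | _ => signedPerm (load q₀ fun z => q₁ z.2.1) (fun _ => false) *
        (diffusion (fun w => decide (j / 4 < J w.2)) *
          signedPerm (load q₀ fun z => q₁ z.2.1) fun _ => false)

/-- After `r` whole iterations, the answer registers are clear again, and the query register is
loaded for the first query of the next iteration. -/
theorem state_search {R : Type} (q₀ : I) (q₁ : T → I) (q₂ : A → I)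
    (marked : A → A → Bool) (w : ι → ℝ) (J : ι → ℕ)
    (V : Matrix.unitaryGroup (I × A × T × A × ι) ℂ) (M : ℕ) (init : I × A × T × A × ι)
    (out : I × A × T × A × ι → R) (f : I → A)
    (hV : Matrix.mulVec V.1 (Pi.single init 1)
      = superpose (fun u : T × ι => (q₀, 0, u.1, 0, u.2))
        (searchAmplitude (fun p => marked (f (q₁ p)) (f (q₂ (f (q₁ p))))) w J 0)) (r : ℕ) :
    QueryAlgorithm.state ⟨T × A × ι, M, searchUnitary q₀ q₁ q₂ marked J V, init, out⟩ f (4 * r)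
      = superpose (fun u : T × ι => (q₁ u.1, 0, u.1, 0, u.2))
        (searchAmplitude (fun p => marked (f (q₁ p)) (f (q₂ (f (q₁ p))))) w J r) := by
  set P : QueryAlgorithm I A R := ⟨T × A × ι, M, searchUnitary q₀ q₁ q₂ marked J V, init, out⟩
  set b : T → Bool := fun p => marked (f (q₁ p)) (f (q₂ (f (q₁ p)))) with hb
  induction r with
  | zero =>
    change Matrix.mulVec (signedPerm (load q₀ fun z => q₁ z.2.1) (fun _ => false) * V).1
      (Pi.single init 1) = _
    rw [Submonoid.coe_mul, ← Matrix.mulVec_mulVec, hV, signedPerm_false_mulVec_superpose]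
    simp
  | succ r ih =>
    have h1 : P.state f (4 * r + 1)
        = superpose (fun u : T × ι => (q₂ (f (q₁ u.1)), 0, u.1, f (q₁ u.1), u.2))
          (searchAmplitude b w J r) := by
      have hU : searchUnitary q₀ q₁ q₂ marked J V (4 * r + 1)
          = signedPerm (((load q₀ fun z => q₁ z.2.1).trans exchange).trans
            (load q₀ fun z => q₂ z.2.2.1)) fun _ => false := by
        simp [searchUnitary]
      change Matrix.mulVec (searchUnitary q₀ q₁ q₂ marked J V (4 * r + 1)).1
        (query f (P.state f (4 * r))) = _
      rw [hU, ih, query_superpose, signedPerm_false_mulVec_superpose]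
      simp
    have h2 : P.state f (4 * r + 2)
        = superpose (fun u : T × ι =>
            (q₂ (f (q₁ u.1)), -f (q₂ (f (q₁ u.1))), u.1, f (q₁ u.1), u.2))
          (fun u => (if (decide (r < J u.2) && !b u.1) then -1 else 1)
            * searchAmplitude b w J r u) := by
      have hU : searchUnitary q₀ q₁ q₂ marked J V (4 * r + 2)
          = signedPerm negAnswer fun z =>
            decide (r < J z.2.2.2.2) && !marked z.2.2.2.1 z.2.1 := by
        have : (4 * r + 1) / 4 = r := by omega
        simp [searchUnitary, this]
      change Matrix.mulVec (searchUnitary q₀ q₁ q₂ marked J V (4 * r + 2)).1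
        (query f (P.state f (4 * r + 1))) = _
      rw [hU, h1, query_superpose, signedPerm_mulVec_superpose]
      simp [hb]
    have h3 : P.state f (4 * r + 3)
        = superpose (fun u : T × ι => (q₁ u.1, -f (q₁ u.1), u.1, 0, u.2))
          (fun u => (if (decide (r < J u.2) && !b u.1) then -1 else 1)
            * searchAmplitude b w J r u) := by
      have hU : searchUnitary q₀ q₁ q₂ marked J V (4 * r + 3)
          = signedPerm ((((load q₀ fun z => q₂ z.2.2.1).trans exchange).trans negAnswer).trans
            (load q₀ fun z => q₁ z.2.1)) fun _ => false := by
        simp [searchUnitary]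
      change Matrix.mulVec (searchUnitary q₀ q₁ q₂ marked J V (4 * r + 3)).1
        (query f (P.state f (4 * r + 2))) = _
      rw [hU, h2, query_superpose, signedPerm_false_mulVec_superpose]
      simp
    have hU : searchUnitary q₀ q₁ q₂ marked J V (4 * r + 4)
        = signedPerm (load q₀ fun z => q₁ z.2.1) (fun _ => false) *
          (diffusion (fun w => decide (r < J w.2)) *
            signedPerm (load q₀ fun z => q₁ z.2.1) fun _ => false) := by
      have : (4 * r + 3) / 4 = r := by omega
      simp [searchUnitary, this]
    change Matrix.mulVec (searchUnitary q₀ q₁ q₂ marked J V (4 * r + 4)).1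
      (query f (P.state f (4 * r + 3))) = _
    rw [hU, h3, query_superpose, Submonoid.coe_mul, ← Matrix.mulVec_mulVec, Submonoid.coe_mul,
      ← Matrix.mulVec_mulVec, signedPerm_false_mulVec_superpose]
    have hload : (fun u : T × ι => (load q₀ (fun z : A × T × A × ι => q₁ z.2.1))
        ((q₁ u.1, -f (q₁ u.1), u.1, (0 : A), u.2).1,
          (q₁ u.1, -f (q₁ u.1), u.1, (0 : A), u.2).2.1
            + f (q₁ u.1, -f (q₁ u.1), u.1, (0 : A), u.2).1,
          (q₁ u.1, -f (q₁ u.1), u.1, (0 : A), u.2).2.2))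
        = fun u : T × ι => (q₀, (0 : A), u.1, ((0 : A), u.2)) := by
      simp
    rw [hload, diffusion_mulVec_superpose (w := fun c => ((0 : A), c)),
      signedPerm_false_mulVec_superpose]
    congr 1
    · simp only [load_apply, Equiv.swap_apply_left]
    · ext u
      rw [searchAmplitude_succ]

theorem toOuterMeasure_run {R : Type} (P : QueryAlgorithm I A R) (f : I → A) (s : Set R)
    [DecidablePred (· ∈ s)] :
    (P.run f).toOuterMeasure s = ENNReal.ofReal
      (∑ z ∈ Finset.univ.filter (fun z => P.out z ∈ s), ‖P.state f P.queries z‖ ^ 2) := by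
  rw [run, PMF.toOuterMeasure_map_apply, PMF.toOuterMeasure_ofFintype_apply, tsum_fintype,
    ENNReal.ofReal_sum_of_nonneg (fun z _ => by positivity), Finset.sum_filter]
  refine Finset.sum_congr rfl fun z _ => ?_
  by_cases hz : P.out z ∈ s
  · rw [if_pos hz, Set.indicator_of_mem (show z ∈ P.out ⁻¹' s from hz)]
  · rw [if_neg hz, Set.indicator_of_notMem (show z ∉ P.out ⁻¹' s from hz)]

theorem toOuterMeasure_run_of_iff_eq {R : Type} (P : QueryAlgorithm I A R) (f : I → A) (s : Set R)
    (y : I × A × P.Work) (hs : ∀ z, P.out z ∈ s ↔ z = y) :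
    (P.run f).toOuterMeasure s = ENNReal.ofReal (‖P.state f P.queries y‖ ^ 2) := by
  classical
  rw [toOuterMeasure_run]
  simp [hs, Finset.filter_eq']

theorem toOuterMeasure_run_of_iff_ne {R : Type} (P : QueryAlgorithm I A R) (f : I → A) (s : Set R)
    (y : I × A × P.Work) (hs : ∀ z, P.out z ∈ s ↔ z ≠ y) :
    (P.run f).toOuterMeasure s = ENNReal.ofReal (1 - ‖P.state f P.queries y‖ ^ 2) := by
  classical
  rw [toOuterMeasure_run, ← sum_norm_sq_state P f P.queries,
    ← Finset.add_sum_erase _ _ (Finset.mem_univ y), add_sub_cancel_left]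
  simp [hs, Finset.filter_ne']

/-- A search with `4 M` queries whose result is `e` exactly if the final measurement finds the
initial basis state, which happens with probability `(g φ) ^ 2`. -/
theorem exists_search {M : ℕ} {g : ℝ → ℝ} (hg : g ∈ cosineMixtures M) (q₀ : I) (q₁ : T → I)
    (q₂ : A → I) (marked : A → A → Bool) (e : Bool) :
    ∃ P : QueryAlgorithm I A Bool, P.queries = 4 * M ∧ ∀ (f : I → A) (φ : ℝ),
      Real.cos φ = 1 - 2 * (((Finset.univ.filter fun p : T =>
        marked (f (q₁ p)) (f (q₂ (f (q₁ p))))).card : ℝ) / Fintype.card T) →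
      (P.run f).toOuterMeasure {b | b ≠ e} = ENNReal.ofReal (1 - g φ ^ 2) ∧
      (P.run f).toOuterMeasure {b | b ≠ !e} = ENNReal.ofReal (g φ ^ 2) := by
  classical
  obtain ⟨ι, _, w, h, hw0, hw1, hh, rfl⟩ := mem_convexHull_iff_exists_fintype.mp hg
  choose J hJM hJ using hh
  have hd : (0 : ℝ) < Fintype.card T := by exact_mod_cast Fintype.card_pos
  have hι : Nonempty ι := by
    by_contra hne
    rw [not_nonempty_iff] at hne
    simp at hw1
  set Φ : I × A × T × A × ι → ℂ := superpose (fun u : T × ι => (q₀, 0, u.1, 0, u.2))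
    (searchAmplitude (fun _ => false) w J 0) with hΦ
  have hinj : Function.Injective fun u : T × ι => (q₀, (0 : A), u.1, (0 : A), u.2) := by
    intro u v huv
    simp only [Prod.mk.injEq, true_and] at huv
    exact Prod.ext huv.1 huv.2
  have hamp : ∀ (m : T → Bool) (r : ℕ),
      ∑ u : T × ι, star (searchAmplitude (fun _ => false) w J 0 u) * searchAmplitude m w J r u
        = ((∑ c, w c * ∑ p, 1 / √(Fintype.card T : ℝ) * (groverStep m)^[min r (J c)]
            (fun _ => 1 / √(Fintype.card T : ℝ)) p : ℝ) : ℂ) := by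
    intro m r
    rw [Fintype.sum_prod_type_right, Complex.ofReal_sum]
    refine Finset.sum_congr rfl fun c _ => ?_
    rw [Finset.mul_sum, Complex.ofReal_sum]
    refine Finset.sum_congr rfl fun p _ => ?_
    rw [searchAmplitude, searchAmplitude, Complex.star_def, Complex.conj_ofReal,
      ← Complex.ofReal_mul]
    congr 1
    have := Real.mul_self_sqrt (hw0 c)
    simp only [Nat.zero_min, Function.iterate_zero, id_eq]
    linear_combination (1 / √(Fintype.card T : ℝ) * (groverStep m)^[min r (J c)]
      (fun _ => 1 / √(Fintype.card T : ℝ)) p) * this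
  have hnorm : ∑ z, ‖Φ z‖ ^ 2 = 1 := by
    have h1 : ((∑ z, ‖Φ z‖ ^ 2 : ℝ) : ℂ) = ∑ z, star (Φ z) * Φ z := by
      push_cast
      exact Finset.sum_congr rfl fun z _ => (Complex.conj_mul' _).symm
    rw [hΦ, sum_star_superpose_mul_superpose hinj, hamp] at h1
    have h2 := Complex.ofReal_injective h1
    rw [h2]
    have h3 : 1 / √(Fintype.card T : ℝ) * (1 / √(Fintype.card T : ℝ))
        = (Fintype.card T : ℝ)⁻¹ := by
      rw [div_mul_div_comm, Real.mul_self_sqrt hd.le, one_mul, one_div]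
    simp only [Nat.zero_min, Function.iterate_zero, id_eq, h3, Finset.sum_const,
      Finset.card_univ, nsmul_eq_mul, mul_inv_cancel₀ hd.ne', mul_one, hw1]
  -- any basis state would do, since `V` maps it to `Φ`
  set init : I × A × T × A × ι := (q₀, 0, Classical.arbitrary T, 0, Classical.arbitrary ι)
  obtain ⟨V, hV⟩ := exists_unitary_mulVec_single init Φ hnorm
  set P₀ : QueryAlgorithm I A Bool := ⟨T × A × ι, 4 * M, searchUnitary q₀ q₁ q₂ marked J V, init,
    fun z => if z = init then e else !e⟩
  set L : Matrix.unitaryGroup (I × A × T × A × ι) ℂ :=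
    signedPerm (load q₀ fun z => q₁ z.2.1) (fun _ => false) with hL
  -- the last unitary clears the query register and reverses the preparation of `Φ`, so that the
  -- amplitude of `init` becomes the inner product with `Φ`
  set P : QueryAlgorithm I A Bool := P₀.withFinal (star V * L)
  refine ⟨P, rfl, fun f φ hφ => ?_⟩
  have hzero : ∀ m : T → Bool,
      searchAmplitude m w J 0 = searchAmplitude (fun _ => false) w J 0 := by
    intro m
    ext u
    simp [searchAmplitude]
  have hfinal : P.state f P.queries init
      = ((∑ i, w i • h i) φ : ℝ) := by
    have h1 : P.state f P.queries = Matrix.mulVec (star V * L).1 (P₀.state f (4 * M)) :=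
      withFinal_state P₀ (star V * L) f
    have h2 : P₀.state f (4 * M) = _ :=
      state_search q₀ q₁ q₂ marked w J V (4 * M) init _ f
        (by rw [hV, hΦ, hzero fun p => marked (f (q₁ p)) (f (q₂ (f (q₁ p))))]) M
    rw [h1, h2, Submonoid.coe_mul, ← Matrix.mulVec_mulVec, hL, signedPerm_false_mulVec_superpose]
    have h3 : ∀ z, V.1 z init = Φ z := fun z => by
      rw [← hV]
      simp
    simp only [load_apply, Equiv.swap_apply_right]
    change ∑ z, star (V.1 z init) * _ = _
    simp only [h3]
    rw [hΦ, sum_star_superpose_mul_superpose hinj, hamp]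
    congr 1
    rw [Finset.sum_apply]
    refine Finset.sum_congr rfl fun c _ => ?_
    rw [min_eq_right (hJM c), sum_groverStep_iterate _ hφ, Pi.smul_apply, smul_eq_mul, hJ c]
  have hsq : ‖P.state f P.queries init‖ ^ 2 = (∑ i, w i • h i) φ ^ 2 := by
    rw [hfinal, Complex.norm_real, Real.norm_eq_abs, sq_abs]
  have hout : ∀ z : I × A × T × A × ι, P.out z = if z = init then e else !e := fun _ => rfl
  have hmem : ∀ z : I × A × T × A × ι, (P.out z ∈ {b | b ≠ !e}) ↔ z = init := by
    intro z
    rw [hout]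
    by_cases hz : z = init <;> cases e <;> simp [hz]
  have hmem' : ∀ z : I × A × T × A × ι, (P.out z ∈ {b | b ≠ e}) ↔ z ≠ init := by
    intro z
    rw [hout]
    by_cases hz : z = init <;> cases e <;> simp [hz]
  rw [← hsq]
  exact ⟨toOuterMeasure_run_of_iff_ne P f _ init hmem',
    toOuterMeasure_run_of_iff_eq P f _ init hmem⟩

end Search

end QueryAlgorithm

/-! ### Boosted subroutines for AND and OR -/

theorem eq_one_of_mem_cosineMixtures {M : ℕ} {f : ℝ → ℝ} (hf : f ∈ cosineMixtures M) :
    f 0 = 1 := by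
  have hc : Convex ℝ {f : ℝ → ℝ | f 0 ∈ ({1} : Set ℝ)} :=
    (convex_singleton (1 : ℝ)).linear_preimage (LinearMap.proj 0 : (ℝ → ℝ) →ₗ[ℝ] ℝ)
  refine convexHull_min ?_ hc hf
  rintro _ ⟨j, _, rfl⟩
  simp

/-- The argument at an edge, from the answers of the black box for the edge and for the vertex to
which it leads. -/
def argOfAnswers {n : ℕ} (a v : Answer n) : Bool := signed (decide (v.2 = 1)) (decide (a.2 = 1))

theorem decide_toBit_eq_one (b : Bool) : decide (toBit b = 1) = b := by
  cases b <;> decide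

namespace AndOrNotDAG

variable {n N : ℕ} (G : AndOrNotDAG n N)

theorem outDegree_le (i : Fin n) : G.outDegree i ≤ n := by
  simpa [SortedDAG.outDegree] using (G.adj_nodup i).length_le_card

/-- As the out-degree is at most `n`, the reduction modulo `n` in `Fin.ofNat n p` has no effect. -/
theorem args_eq_ofFn [NeZero n] (x : Fin N → Bool) (t : Fin n → Bool) (i : Fin n) :
    G.args x t i = List.ofFn fun p : Fin (G.outDegree i) =>
      argOfAnswers (G.box x t (.inl (i, Fin.ofNat n p)))
        (G.box x t (.inr (G.box x t (.inl (i, Fin.ofNat n p))).1)) := by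
  refine List.ext_getElem (by simp [args, SortedDAG.outDegree]) fun p h1 h2 => ?_
  have hp : p < (G.adj i).length := by simpa [args] using h1
  have hpn : p % n = p := Nat.mod_eq_of_lt (hp.trans_le (G.outDegree_le i))
  simp [args, box, argOfAnswers, hp, hpn, decide_toBit_eq_one]

end AndOrNotDAG

/-- Grover's search, for a true argument in the case of OR and for a false one in the case of AND,
with the mixture of numbers of iterations from `exists_cosineMixture_small`. -/
theorem exists_subroutine {n : ℕ} [NeZero n] (i : Fin n) (h : Gate) {d k : ℕ} (hd : 1 ≤ d)
    (hk : 1 ≤ k) :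
    ∃ P : QueryAlgorithm (Cell n) (Answer n) Bool, (P.queries : ℝ) ≤ 24 * √((k : ℝ) * d) ∧
      ∀ (N : ℕ) (G : AndOrNotDAG n N), G.outDegree i = d →
        ∀ (x : Fin N → Bool) (t : Fin n → Bool),
          (P.run (G.box x t)).toOuterMeasure {b | b ≠ h.eval (G.args x t i)}
            ≤ ENNReal.ofReal (1 / 2 ^ k) := by
  obtain ⟨M, hM, g, hg, hsmall⟩ := exists_cosineMixture_small hd hk
  have : Nonempty (Fin d) := ⟨⟨0, hd⟩⟩
  -- the value of the gate when no argument is the one that is searched for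
  set e : Bool := match h with
    | .and => true
    | .or => false with he
  obtain ⟨P, hP, hrun⟩ := QueryAlgorithm.exists_search (T := Fin d) hg (.inr 0 : Cell n)
    (fun p => .inl (i, Fin.ofNat n p)) (fun a : Answer n => .inr a.1)
    (fun a v => argOfAnswers a v ^^ e) e
  refine ⟨P, by rw [hP]; push_cast; linarith, fun N G hG x t => ?_⟩
  subst hG
  set arg : Fin (G.outDegree i) → Bool := fun p =>
    argOfAnswers (G.box x t (.inl (i, Fin.ofNat n p)))
      (G.box x t (.inr (G.box x t (.inl (i, Fin.ofNat n p))).1)) with harg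
  have hargs : G.args x t i = List.ofFn arg := G.args_eq_ofFn x t i
  have hrun' := hrun (G.box x t)
  set c := (Finset.univ.filter fun p => (arg p ^^ e) = true).card with hc
  have hcd : c ≤ G.outDegree i := by
    rw [← Fintype.card_fin (G.outDegree i)]
    exact Finset.card_le_univ _
  have heval : h.eval (G.args x t i) = if c = 0 then e else !e := by
    have hc0 : c = 0 ↔ ∀ p, arg p = e := by
      rw [hc, Finset.card_eq_zero, Finset.filter_eq_empty_iff]
      simp
    rw [hargs]
    cases h
    · have : (List.ofFn arg).all id = decide (∀ p, arg p = true) := by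
        rw [Bool.eq_iff_iff]
        simp [List.all_eq_true]
      simp only [Gate.eval, this, hc0, he]
      by_cases h' : ∀ p, arg p = true <;> simp [h']
    · have : (List.ofFn arg).any id = !decide (∀ p, arg p = false) := by
        rw [Bool.eq_iff_iff]
        simp [List.any_eq_true, List.mem_ofFn]
      simp only [Gate.eval, this, hc0, he]
      by_cases h' : ∀ p, arg p = false <;> simp [h']
  rw [heval]
  by_cases hc0 : c = 0
  · have h1 := (hrun' 0 (by simp [hc0])).1
    rw [if_pos hc0, h1, eq_one_of_mem_cosineMixtures hg]
    simp
  · have hmem : c ∈ Finset.Icc 1 (G.outDegree i) := Finset.mem_Icc.mpr ⟨by omega, hcd⟩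
    have hd0 : (0 : ℝ) < G.outDegree i := by exact_mod_cast hd
    have hr1 : (c : ℝ) / G.outDegree i ≤ 1 := by
      rw [div_le_one hd0]
      exact_mod_cast hcd
    have hr0 : 0 ≤ (c : ℝ) / G.outDegree i := by positivity
    have h1 := (hrun' (Real.arccos (1 - 2 * ((c : ℝ) / G.outDegree i))) (by
      rw [Real.cos_arccos (by linarith) (by linarith), Fintype.card_fin])).2
    rw [if_neg hc0, h1]
    apply ENNReal.ofReal_le_ofReal
    have h2 := hsmall c hmem
    have h3 : (1 : ℝ) / 2 ^ k ≤ 1 := by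
      rw [div_le_one (by positivity)]
      exact one_le_pow₀ (by norm_num)
    rw [← sq_abs]
    nlinarith [abs_nonneg (g (Real.arccos (1 - 2 * ((c : ℝ) / G.outDegree i))))]

theorem exists_isBoosted : ∃ Q : Subroutines, IsBoosted 24 Q := by
  have hex : ∀ (n : ℕ) (i : Fin n) (h : Gate) (d k : ℕ),
      ∃ P : QueryAlgorithm (Cell n) (Answer n) Bool, ∀ [NeZero n], 1 ≤ d → 1 ≤ k →
        (P.queries : ℝ) ≤ 24 * √((k : ℝ) * d) ∧
        ∀ (N : ℕ) (G : AndOrNotDAG n N), G.outDegree i = d →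
          ∀ (x : Fin N → Bool) (t : Fin n → Bool),
            (P.run (G.box x t)).toOuterMeasure {b | b ≠ h.eval (G.args x t i)}
              ≤ ENNReal.ofReal (1 / 2 ^ k) := by
    intro n i h d k
    have : NeZero n := ⟨i.pos.ne'⟩
    -- the maxima matter only for `d = 0` or `k = 0`, where any algorithm will do
    obtain ⟨P, hP⟩ := exists_subroutine i h (le_max_right d 1) (le_max_right k 1)
    refine ⟨P, fun hd hk => ?_⟩
    rwa [max_eq_left hd, max_eq_left hk] at hP
  choose Q hQ using hex
  refine ⟨Q, fun n N _ G i h k hd hk => ?_⟩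
  obtain ⟨h1, h2⟩ := hQ n i h (G.outDegree i) k (Nat.one_le_iff_ne_zero.mpr hd) hk
  refine ⟨h1, fun x t => (h2 N G rfl x t).trans (ENNReal.ofReal_le_ofReal ?_)⟩
  gcongr
  norm_num

theorem IsBoosted.mono {C C' : ℝ} {Q : Subroutines} (hQ : IsBoosted C Q) (h : C ≤ C') :
    IsBoosted C' Q := by
  intro n N _ G i g k hd hk
  obtain ⟨h1, h2⟩ := hQ n N G i g k hd hk
  refine ⟨h1.trans (by gcongr), fun x t => (h2 x t).trans (ENNReal.ofReal_le_ofReal ?_)⟩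
  gcongr

/-! ### Evaluation of the graph -/

theorem PMF.toOuterMeasure_bind_le {α β : Type*} (p : PMF α) (F : α → PMF β) (s : Set β)
    (good : α → Prop) {ε δ : ENNReal} (hp : p.toOuterMeasure {a | ¬good a} ≤ ε)
    (hF : ∀ a, good a → (F a).toOuterMeasure s ≤ δ) :
    (p.bind F).toOuterMeasure s ≤ ε + δ := by
  classical
  rw [PMF.toOuterMeasure_bind_apply]
  calc ∑' a, p a * (F a).toOuterMeasure s
      ≤ ∑' a, ({a | ¬good a}.indicator p a + p a * δ) := by
        refine ENNReal.tsum_le_tsum fun a => ?_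
        by_cases ha : good a
        · exact (mul_le_mul_right (hF a ha) _).trans le_add_self
        · rw [Set.indicator_of_mem (show a ∈ {a | ¬good a} from ha)]
          have h1 : (F a).toOuterMeasure s ≤ 1 := by
            rw [← (PMF.toOuterMeasure_apply_eq_one_iff (F a) (s := Set.univ)).mpr
              (Set.subset_univ _)]
            exact (F a).toOuterMeasure.mono (Set.subset_univ _)
          calc p a * (F a).toOuterMeasure s ≤ p a * 1 := mul_le_mul_right h1 _
            _ = p a := mul_one _
            _ ≤ _ := le_self_add
    _ = p.toOuterMeasure {a | ¬good a} + δ := by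
        rw [ENNReal.tsum_add, ENNReal.tsum_mul_right, p.tsum_coe, one_mul,
          PMF.toOuterMeasure_apply]
    _ ≤ ε + δ := by gcongr

/-- The union bound for a loop: if every pass preserves the invariant up to an error of
probability `ε`, then the whole loop does up to `ε` times the number of passes. -/
theorem PMF.toOuterMeasure_foldlM_le {σ ι : Type} (step : σ → ι → PMF σ)
    (good : List ι → σ → Prop) (l : List ι) {ε : ENNReal}
    (h : ∀ pre i post, l = pre ++ i :: post → ∀ st, good pre st →
      (step st i).toOuterMeasure {st' | ¬good (pre ++ [i]) st'} ≤ ε) :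
    ∀ post pre, l = pre ++ post → ∀ st, good pre st →
      (post.foldlM step st).toOuterMeasure {st' | ¬good l st'} ≤ post.length * ε := by
  intro post
  induction post with
  | nil =>
    intro pre hl st hst
    rw [List.append_nil] at hl
    subst hl
    change (PMF.pure st).toOuterMeasure _ ≤ _
    rw [PMF.toOuterMeasure_pure_apply]
    simp [hst]
  | cons i post ih =>
    intro pre hl st hst
    rw [List.foldlM_cons]
    refine (PMF.toOuterMeasure_bind_le (step st i) _ _ (good (pre ++ [i]))
      (h pre i post hl st hst) fun st' hst' => ih (pre ++ [i]) (by simp [hl]) st' hst').trans ?_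
    rw [List.length_cons]
    push_cast
    rw [add_mul, one_mul, add_comm]

namespace AndOrNotDAG

variable {n N : ℕ} (G : AndOrNotDAG n N)

theorem nHat_le : G.nHat ≤ n := Nat.sub_le _ _

theorem card_lt_nHat : (Finset.univ.filter fun i : Fin n => (i : ℕ) < G.nHat).card = G.nHat := by
  rw [Fin.card_filter_val_lt, min_eq_right G.nHat_le]

/-- There are as many sinks as vertices from `n̂` on, and these are sinks. -/
theorem outDegree_ne_zero {i : Fin n} (hi : (i : ℕ) < G.nHat) : G.outDegree i ≠ 0 := by
  have hsub : (Finset.univ.filter fun i : Fin n => ¬(i : ℕ) < G.nHat) ⊆ G.sinks := by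
    intro j hj
    simp only [Finset.mem_filter, Finset.mem_univ, true_and, not_lt] at hj
    simpa [SortedDAG.sinks] using G.sinks_last j hj
  have hcard := Finset.card_filter_add_card_filter_not (s := (Finset.univ : Finset (Fin n)))
    (fun i : Fin n => (i : ℕ) < G.nHat)
  rw [card_lt_nHat, Finset.card_univ, Fintype.card_fin] at hcard
  have hle : G.sinks.card ≤ n := by simpa using Finset.card_le_univ G.sinks
  have hn : G.nHat = n - G.sinks.card := rfl
  have heq := Finset.eq_of_subset_of_card_le hsub (by omega)
  intro h0
  have : i ∈ G.sinks := by simpa [SortedDAG.sinks] using h0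
  rw [← heq] at this
  simp only [Finset.mem_filter] at this
  exact this.2 hi

theorem card_edges : G.edges.card = ∑ i, G.outDegree i := by
  rw [SortedDAG.edges, Finset.card_filter, Fintype.sum_prod_type]
  refine Finset.sum_congr rfl fun i _ => ?_
  rw [← Finset.card_filter, SortedDAG.outDegree, ← List.toFinset_card_of_nodup (G.adj_nodup i)]
  congr 1
  ext j
  simp

/-- If the vertices after `v_i` have their right values, then so do the arguments at `v_i`, since
the graph is topologically sorted. -/
theorem eval_args_eq_value (x : Fin N → Bool) (t : Fin n → Bool) {i : Fin n}
    (hi : (i : ℕ) < G.nHat) (ht : ∀ j, i < j → (j : ℕ) < G.nHat → t j = G.value x j) :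
    (G.gate i).eval (G.args x t i) = G.value x i := by
  rw [value, if_neg (G.outDegree_ne_zero hi), args]
  congr 1
  simp only [List.map_attach_eq_pmap, List.pmap_eq_map]
  refine List.map_congr_left fun j hj => ?_
  congr 1
  rw [tf]
  split_ifs with hlt
  · exact ht j (G.topological i j hj) hlt
  · rw [value, if_pos (G.sinks_last j (not_lt.mp hlt))]

theorem mem_order {i : Fin n} : i ∈ G.order ↔ G.root ≤ i ∧ (i : ℕ) < G.nHat := by
  simp [order]

theorem pairwise_order : G.order.Pairwise (· > ·) := by
  rw [order, List.pairwise_reverse]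
  exact (List.pairwise_lt_finRange n).filter _

theorem length_order_le : G.order.length ≤ G.nHat := by
  have hnd : G.order.Nodup := G.pairwise_order.imp fun h => ne_of_gt h
  rw [← List.toFinset_card_of_nodup hnd, ← G.card_lt_nHat]
  refine Finset.card_le_card fun i hi => ?_
  rw [List.mem_toFinset, mem_order] at hi
  simpa using hi.2

/-- `2 log₂ n̂ + 1 ≤ 3 log₂ n̂`, and `3 / log 2 < 5`. -/
theorem boost_le (h2 : 2 ≤ G.nHat) : (G.boost : ℝ) ≤ 5 * Real.log G.nHat := by
  have h2' : (2 : ℝ) ≤ G.nHat := by exact_mod_cast h2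
  have hlog2 := Real.log_two_gt_d9
  have hlog : Real.log 2 ≤ Real.log G.nHat := Real.log_le_log (by norm_num) h2'
  have h1 : 1 ≤ Real.logb 2 G.nHat := by
    rw [Real.logb, le_div_iff₀ (by linarith), one_mul]
    exact hlog
  have h3 : Real.logb 2 (G.nHat : ℝ) ≤ 5 / 3 * Real.log G.nHat := by
    rw [Real.logb, div_le_iff₀ (by linarith)]
    nlinarith
  have := Nat.ceil_lt_add_one (show 0 ≤ 2 * Real.logb 2 (G.nHat : ℝ) by linarith)
  rw [boost]
  linarith

theorem one_le_boost (h2 : 2 ≤ G.nHat) : 1 ≤ G.boost := by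
  have h2' : (2 : ℝ) ≤ G.nHat := by exact_mod_cast h2
  exact Nat.one_le_ceil_iff.mpr (mul_pos two_pos (Real.logb_pos (by norm_num) (by linarith)))

/-- The error `O(1 / 2 ^ k)` of a subroutine is `O(1 / n̂ ^ 2)`. -/
theorem sq_nHat_le (h2 : 2 ≤ G.nHat) : (G.nHat : ℝ) ^ 2 ≤ 2 ^ G.boost := by
  have h0 : (0 : ℝ) < G.nHat := by exact_mod_cast (by omega : 0 < G.nHat)
  calc (G.nHat : ℝ) ^ 2 = (2 : ℝ) ^ (2 * Real.logb 2 (G.nHat : ℝ)) := by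
        rw [mul_comm, Real.rpow_mul (by norm_num), Real.rpow_logb (by norm_num) (by norm_num) h0]
        norm_num
    _ ≤ (2 : ℝ) ^ (G.boost : ℝ) := by
        exact Real.rpow_le_rpow_of_exponent_le (by norm_num) (Nat.le_ceil _)
    _ = 2 ^ G.boost := Real.rpow_natCast _ _

variable [NeZero n]

/-- The number of queries does not depend on the outcomes of the measurements. -/
theorem snd_of_mem_support_foldlM (Q : Subroutines) (x : Fin N → Bool) (l : List (Fin n)) :
    ∀ (st : (Fin n → Bool) × ℕ), ∀ r ∈ (l.foldlM (G.step Q x) st).support,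
      r.2 = st.2 + (l.map fun i =>
        1 + (Q n i (G.gate i) (G.outDegree i) G.boost).queries).sum := by
  induction l with
  | nil =>
    intro st r hr
    have : r = st := by simpa using (PMF.mem_support_pure_iff st r).mp hr
    simp [this]
  | cons i l ih =>
    intro st r hr
    rw [List.foldlM_cons] at hr
    obtain ⟨st', hst', hr⟩ := (PMF.mem_support_bind_iff _ _ _).mp hr
    obtain ⟨b, -, rfl⟩ := (PMF.mem_support_map_iff _ _ _).mp hst'
    rw [ih _ r hr, List.map_cons, List.sum_cons]
    simp only
    omega

/-- By the Cauchy-Schwarz inequality, `∑ √(k d_i) ≤ √(k n̂ m)` for the sum over the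
function-vertices. -/
theorem sum_queries_le {C : ℝ} (hC : 0 ≤ C) {Q : Subroutines} (hQ : IsBoosted C Q)
    (h2 : 2 ≤ G.nHat) :
    (((G.order.map fun i => 1 + (Q n i (G.gate i) (G.outDegree i) G.boost).queries).sum : ℕ) : ℝ)
      ≤ (3 * C + 2) * √((G.nHat : ℝ) * (G.edges.card : ℝ) * Real.log (G.nHat : ℝ)) := by
  set F := Finset.univ.filter fun i : Fin n => (i : ℕ) < G.nHat with hF
  have hnd : G.order.Nodup := G.pairwise_order.imp fun h => ne_of_gt h
  have hsub : G.order.toFinset ⊆ F := fun i hi => by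
    rw [List.mem_toFinset, mem_order] at hi
    simpa [hF] using hi.2
  have hdeg : ∑ i ∈ F, (G.outDegree i : ℝ) ≤ G.edges.card := by
    rw [card_edges]
    push_cast
    exact Finset.sum_le_univ_sum_of_nonneg fun _ => by positivity
  have hnm : (G.nHat : ℝ) ≤ G.edges.card := by
    refine le_trans ?_ hdeg
    rw [← G.card_lt_nHat, Finset.card_eq_sum_ones]
    push_cast
    refine Finset.sum_le_sum fun i hi => ?_
    exact_mod_cast Nat.one_le_iff_ne_zero.mpr (G.outDegree_ne_zero (by simpa using hi))
  have hlog : (1 : ℝ) / 2 ≤ Real.log G.nHat := by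
    have := Real.log_two_gt_d9
    have : Real.log 2 ≤ Real.log G.nHat :=
      Real.log_le_log (by norm_num) (by exact_mod_cast h2)
    linarith
  set S := √((G.nHat : ℝ) * (G.edges.card : ℝ) * Real.log (G.nHat : ℝ)) with hS
  have hcs : ∑ i ∈ F, √((G.boost : ℝ) * G.outDegree i) ≤ 3 * S := by
    have h1 := Real.sum_sqrt_mul_sqrt_le F (f := fun _ => (1 : ℝ))
      (g := fun i => (G.boost : ℝ) * G.outDegree i) (fun _ => by positivity)
      (fun _ => by positivity)
    simp only [Real.sqrt_one, one_mul, Finset.sum_const, hF, G.card_lt_nHat, nsmul_eq_mul,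
      mul_one] at h1
    refine h1.trans ?_
    rw [← Real.sqrt_mul (by positivity), ← Finset.mul_sum]
    calc √((G.nHat : ℝ) * (G.boost * ∑ i ∈ F, (G.outDegree i : ℝ)))
        ≤ √(3 ^ 2 * ((G.nHat : ℝ) * (G.edges.card : ℝ) * Real.log (G.nHat : ℝ))) := by
          apply Real.sqrt_le_sqrt
          have hb := G.boost_le h2
          calc (G.nHat : ℝ) * (G.boost * ∑ i ∈ F, (G.outDegree i : ℝ))
              ≤ G.nHat * ((5 * Real.log G.nHat) * G.edges.card) := by gcongr
            _ ≤ _ := by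
              have : 0 ≤ (G.nHat : ℝ) * (G.edges.card : ℝ) * Real.log (G.nHat : ℝ) := by positivity
              linarith
      _ = 3 * S := by rw [Real.sqrt_mul (by positivity), Real.sqrt_sq (by norm_num)]
  -- the queries for the labels and degrees: there is one for each vertex, and `n̂ ≤ m`
  have hone : (G.nHat : ℝ) ≤ 2 * S := by
    have h1 : (G.nHat : ℝ) ≤ √(2 ^ 2 * ((G.nHat : ℝ) * (G.edges.card : ℝ)
        * Real.log (G.nHat : ℝ))) := by
      apply Real.le_sqrt_of_sq_le
      have : (G.nHat : ℝ) * G.nHat ≤ G.nHat * G.edges.card := by gcongr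
      have h3 : 0 ≤ (G.nHat : ℝ) * G.edges.card := by positivity
      nlinarith
    rwa [Real.sqrt_mul (by positivity), Real.sqrt_sq (by norm_num)] at h1
  rw [← List.sum_toFinset _ hnd]
  push_cast
  calc ∑ i ∈ G.order.toFinset, (1 + ((Q n i (G.gate i) (G.outDegree i) G.boost).queries : ℝ))
      ≤ ∑ i ∈ F, (1 + ((Q n i (G.gate i) (G.outDegree i) G.boost).queries : ℝ)) :=
        Finset.sum_le_sum_of_subset_of_nonneg hsub fun _ _ _ => by positivity
    _ ≤ ∑ i ∈ F, (1 + C * √((G.boost : ℝ) * G.outDegree i)) := by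
        refine Finset.sum_le_sum fun i hi => ?_
        have := (hQ n N G i (G.gate i) G.boost (G.outDegree_ne_zero (by simpa [hF] using hi))
          (G.one_le_boost h2)).1
        linarith
    _ = G.nHat + C * ∑ i ∈ F, √((G.boost : ℝ) * G.outDegree i) := by
        rw [Finset.sum_add_distrib, ← Finset.mul_sum]
        simp [hF, G.card_lt_nHat]
    _ ≤ 2 * S + C * (3 * S) := by gcongr
    _ = (3 * C + 2) * S := by ring

theorem toOuterMeasure_evalAlgorithm_le {C : ℝ} (hC : 0 ≤ C) {Q : Subroutines}
    (hQ : IsBoosted C Q) (x : Fin N → Bool) (h2 : 2 ≤ G.nHat) :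
    (G.evalAlgorithm Q x).toOuterMeasure {r | r.1 ≠ G.value x G.root}
      ≤ ENNReal.ofReal (C / (G.nHat : ℝ)) := by
  have hn0 : (0 : ℝ) < G.nHat := by exact_mod_cast (by omega : 0 < G.nHat)
  have hstep : ∀ pre i post, G.order = pre ++ i :: post → ∀ st : (Fin n → Bool) × ℕ,
      (∀ j ∈ pre, st.1 j = G.value x j) →
      (G.step Q x st i).toOuterMeasure {st' | ¬∀ j ∈ pre ++ [i], st'.1 j = G.value x j}
        ≤ ENNReal.ofReal (C / 2 ^ G.boost) := by
    intro pre i post hl st hst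
    have hi : G.root ≤ i ∧ (i : ℕ) < G.nHat := G.mem_order.mp (by simp [hl])
    have hpw := G.pairwise_order
    rw [hl, List.pairwise_append, List.pairwise_cons] at hpw
    have hval := G.eval_args_eq_value x st.1 hi.2 fun j hij hj => hst j (by
      have hmem : j ∈ G.order := G.mem_order.mpr ⟨hi.1.trans hij.le, hj⟩
      rw [hl, List.mem_append, List.mem_cons] at hmem
      rcases hmem with h | h | h
      · exact h
      · exact (hij.ne' h).elim
      · exact (lt_asymm hij (hpw.2.1.1 j h)).elim)
    refine le_trans ?_ ((hQ n N G i (G.gate i) G.boost (G.outDegree_ne_zero hi.2)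
      (G.one_le_boost h2)).2 x st.1)
    rw [step, PMF.toOuterMeasure_map_apply]
    refine (PMF.toOuterMeasure _).mono ?_
    intro b hb hbv
    refine hb fun j hj => ?_
    rw [hval] at hbv
    by_cases hji : j = i
    · subst hji
      simpa using hbv
    · have : j ∈ pre := by simpa [hji] using hj
      simpa [Function.update_of_ne hji] using hst j this
  have hloop := PMF.toOuterMeasure_foldlM_le (G.step Q x)
    (fun l st => ∀ j ∈ l, st.1 j = G.value x j) G.order hstep G.order [] rfl (fun _ => false, 0)
    (by simp)
  rw [evalAlgorithm, PMF.toOuterMeasure_map_apply]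
  refine ((PMF.toOuterMeasure _).mono ?_).trans (hloop.trans ?_)
  · intro st hst hgood
    exact hst (hgood G.root (G.mem_order.mpr ⟨le_rfl, G.root_lt⟩))
  · calc (G.order.length : ENNReal) * ENNReal.ofReal (C / 2 ^ G.boost)
        ≤ (G.nHat : ENNReal) * ENNReal.ofReal (C / (G.nHat : ℝ) ^ 2) := by
          gcongr
          · exact_mod_cast G.length_order_le
          · exact G.sq_nHat_le h2
      _ = ENNReal.ofReal (C / (G.nHat : ℝ)) := by
          rw [← ENNReal.ofReal_natCast, ← ENNReal.ofReal_mul hn0.le]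
          congr 1
          field_simp

end AndOrNotDAG

theorem theorem1 :
    ∃ (C : ℝ) (Q : Subroutines), 0 < C ∧ IsBoosted C Q ∧
      ∀ (n N : ℕ) [NeZero n] (G : AndOrNotDAG n N) (x : Fin N → Bool), 2 ≤ G.nHat →
        (∀ r ∈ (G.evalAlgorithm Q x).support,
          (r.2 : ℝ) ≤ C * √((G.nHat : ℝ) * (G.edges.card : ℝ) * Real.log (G.nHat : ℝ)) ∧
          (r.2 : ℝ) ≤ C * √((n : ℝ) * (G.edges.card : ℝ) * Real.log (n : ℝ))) ∧
        (G.evalAlgorithm Q x).toOuterMeasure {r | r.1 ≠ G.value x G.root}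
          ≤ ENNReal.ofReal (C / (G.nHat : ℝ)) := by
  obtain ⟨Q, hQ⟩ := exists_isBoosted
  refine ⟨3 * 24 + 2, Q, by norm_num, hQ.mono (by norm_num), fun n N _ G x h2 => ⟨?_, ?_⟩⟩
  · intro r hr
    rw [AndOrNotDAG.evalAlgorithm, PMF.mem_support_map_iff] at hr
    obtain ⟨st, hst, rfl⟩ := hr
    have h1 : (st.2 : ℝ) ≤ (3 * 24 + 2)
        * √((G.nHat : ℝ) * (G.edges.card : ℝ) * Real.log (G.nHat : ℝ)) := by
      rw [G.snd_of_mem_support_foldlM Q x G.order _ st hst, zero_add]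
      exact G.sum_queries_le (by norm_num) hQ h2
    refine ⟨h1, h1.trans ?_⟩
    have h0 : (0 : ℝ) < G.nHat := by exact_mod_cast (by omega : 0 < G.nHat)
    have hle : (G.nHat : ℝ) ≤ n := by exact_mod_cast G.nHat_le
    have hlog : 0 ≤ Real.log (G.nHat : ℝ) := Real.log_natCast_nonneg _
    gcongr
  · exact G.toOuterMeasure_evalAlgorithm_le (by norm_num) (hQ.mono (by norm_num)) x h2
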